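/- Let $n,m\ge 1$ be integers and $0<\alpha<nm$. For $i=1,\dots,m$ let $1<p_i<\frac{nm}{\alpha}$ and define $q_i$, $s_i$ and $q$ by $$\frac1{q_i}=\frac1{p_i}-\frac{\alpha}{nm},\qquad s_i=\Bigl(1-\frac{\alpha}{nm}\Bigr)q_i,\qquad \frac1q=\sum_{i=1}^m\frac1{q_i}.$$ For measurable functions $\vec f=(f_1,\dots,f_m)$ on $\mathbb R^n$ let $$\mathcal M_\alpha\vec f(x)=\sup_{Q\ni x}|Q|^{\alpha/n}\prod_{i=1}^m\frac1{|Q|}\int_Q|f_i|,$$ where the supremum is over all cubes $Q\subset\mathbb R^n$ with sides parallel to the coordinate axes that contain $x$. For $\vec S=(s_1,\dots,s_m)$ with $1< s_i<\infty$ and $\frac1s=\sum_{i=1}^m\frac1{s_i}$, a vector $\vec v=(v_1,\dots,v_m)$ of weights (nonnegative measurable functions on $\mathbb R^n$) is said to satisfy $\vec v\in A_{\vec S}$ if $$\sup_Q\Bigl(\frac1{|Q|}\int_Q\prod_{i=1}^m v_i^{s/s_i}\Bigr)^{1/s}\prod_{i=1}^m\Bigl(\frac1{|Q|}\int_Q v_i^{1-s_i'}\Bigr)^{1/s_i'}<\infty,\qquad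 s_i'=\frac{s_i}{s_i-1},$$ the supremum being over all such cubes. (The choice of $p_i$ above gives $1<s_i<\infty$.) **Theorem.** Let $w_1,\dots,w_m$ be weights on $\mathbb R^n$ such that $(w_1^{q_1},\dots,w_m^{q_m})\in A_{\vec S}$. Then there is a finite constant $C$, independent of $\vec f$, such that for all measurable $\vec f=(f_1,\dots,f_m)$ $$\Bigl\|\mathcal M_\alpha\vec f\,\prod_{i=1}^m w_i\Bigr\|_{L^q(\mathbb R^n)}\le C\prod_{i=1}^m\|f_iw_i\|_{L^{p_i}(\mathbb R^n)}.$$ Here $\|g\|_{L^r}=\bigl(\int|g|^r\bigr)^{1/r}$ also when $0<r<1$, the norms may be infinite, $0^{-t}=\infty$ for $t>0$, and $0\cdot\infty=0$. -/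

import Mathlib

open MeasureTheory
open scoped ENNReal NNReal

noncomputable section

namespace MultiFrac

/-- The cube of `ℝⁿ` with sides parallel to the coordinate axes, lower corner `a` and side length
`r`; it is only used with `0 < r`. -/
def cube {n : ℕ} (a : Fin n → ℝ) (r : ℝ) : Set (Fin n → ℝ) :=
  Set.Icc a (fun j => a j + r)

/-- The multilinear fractional maximal operator
`M_α f (x) = sup_{Q ∋ x} |Q|^{α/n} ∏ᵢ (1/|Q|) ∫_Q |fᵢ|`,
the supremum running over all cubes `Q` with sides parallel to the axes that contain `x`. -/
def fracMaximal {𝕜 : Type*} [RCLike 𝕜] {n m : ℕ} (α : ℝ)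
    (f : Fin m → (Fin n → ℝ) → 𝕜) (x : Fin n → ℝ) : ℝ≥0∞ :=
  ⨆ (a : Fin n → ℝ) (r : ℝ) (_ : 0 < r) (_ : x ∈ cube a r),
    volume (cube a r) ^ (α / n) * ∏ i, ⨍⁻ y in cube a r, ‖f i y‖ₑ ∂volume

/-- The `i`-th factor `((1/|Q|) ∫_Q w^{1-p'})^{1/p'}` of the multilinear Muckenhoupt condition,
with `p' = p/(p-1)`; for `p = 1` it is `(inf_Q w)⁻¹`. A negative power of `0` is `∞`. -/
def dualFactor {n : ℕ} (p : ℝ) (w : (Fin n → ℝ) → ℝ≥0) (Q : Set (Fin n → ℝ)) : ℝ≥0∞ :=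
  if p = 1 then (essInf (fun x => (w x : ℝ≥0∞)) (volume.restrict Q))⁻¹
  else (⨍⁻ x in Q, (w x : ℝ≥0∞) ^ (1 - p.conjExponent) ∂volume) ^ (1 / p.conjExponent)

/-- The exponent `p` with `1/p = ∑ᵢ 1/pᵢ`. -/
def harmonicExponent {m : ℕ} (P : Fin m → ℝ) : ℝ :=
  1 / ∑ i, 1 / P i

/-- The multilinear `A_P` condition, where `1/p = ∑ᵢ 1/pᵢ`:
`sup_Q ((1/|Q|) ∫_Q ∏ᵢ wᵢ^{p/pᵢ})^{1/p} ∏ᵢ ((1/|Q|) ∫_Q wᵢ^{1-pᵢ'})^{1/pᵢ'} < ∞`. -/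
def MultiAP {n m : ℕ} (P : Fin m → ℝ) (w : Fin m → (Fin n → ℝ) → ℝ≥0) : Prop :=
  (⨆ (a : Fin n → ℝ) (r : ℝ) (_ : 0 < r),
    (⨍⁻ x in cube a r, ∏ i, (w i x : ℝ≥0∞) ^ (harmonicExponent P / P i) ∂volume)
        ^ (1 / harmonicExponent P)
      * ∏ i, dualFactor (P i) (w i) (cube a r)) < ∞

end MultiFrac

end

/-! Write `β = α/(nm)`, `e_i = 1/s_i`, `E = ∑ e_i`, `u = (∏ w_i)^q`, `σ_i = w_i^{-p_i'}`. The
exponents are such that the hypothesis reads `(avg u)^E ∏ (avg σ_i)^(1-e_i) ≤ K` over all cubes,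
while `u^E ∏ σ_i^(1-e_i) = 1` pointwise where no weight vanishes.

Hölder bounds `|Q|^β avg f_i` by `(∫ (f_i/σ_i)^{p_i} σ_i)^β` times the power `1-β` of the mean of
`h_i σ_i`, where `h_i = (f_i/σ_i)^{p_i e_i}` (`rpow_mul_prod_setLAverage_le`). This reduces
everything to order zero, up to constants.

For order zero let `M_μ` be the centred maximal function of a measure `μ`. Besicovitch's covering
theorem bounds it on `L^p(μ)` for every `p > 1`, uniformly in `μ` (`exists_strongType_ballMaximal`).
With `θ = min (1-e_i)`, a reverse Jensen inequality (`mul_prod_rpow_le_lintegral`) yields the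
pointwise bound `M(h)^(θ/E) ≤ C M_u((∏ σ_i M_{σ_i} h_i)^(θ/E))` (`prod_setLAverage_rpow_le`). The
bound for `M_u` on `L^{1/θ}(u)`, the pointwise identity, Hölder, and the bounds for `M_{σ_i}` on
`L^{1/e_i}(σ_i)` finish the proof. -/

namespace MultiFrac

/-! ### Centred maximal functions: bounds uniform in the measure. -/

section BallMaximal

open Metric Set

/-- The centred maximal function of `f` with respect to the measure `μ`, over closed balls whose
radius is an integer power of two. -/
noncomputable def ballMaximal {E : Type*} [PseudoMetricSpace E] [MeasurableSpace E] (μ : Measure E)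
    (f : E → ℝ≥0∞) (x : E) : ℝ≥0∞ :=
  ⨆ k : ℤ, ⨍⁻ y in closedBall x ((2 : ℝ) ^ k), f y ∂μ

theorem setLAverage_le_ballMaximal {E : Type*} [PseudoMetricSpace E] [MeasurableSpace E]
    (μ : Measure E) (f : E → ℝ≥0∞) (x : E) (k : ℤ) :
    ⨍⁻ y in closedBall x ((2 : ℝ) ^ k), f y ∂μ ≤ ballMaximal μ f x :=
  le_iSup (fun k : ℤ => ⨍⁻ y in closedBall x ((2 : ℝ) ^ k), f y ∂μ) k

/-- For truncation: a bounded part of `f` adds at most its bound to every average. -/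
theorem ballMaximal_le_add {E : Type*} [PseudoMetricSpace E] [MeasurableSpace E]
    (μ : Measure E) {f g : E → ℝ≥0∞} (c : ℝ≥0∞)
    (h : ∀ x, f x ≤ g x + c) (x : E) : ballMaximal μ f x ≤ ballMaximal μ g x + c := by
  refine iSup_le fun k => ?_
  refine le_trans ?_ (add_le_add_left (setLAverage_le_ballMaximal μ g x k) c)
  simp_rw [setLAverage_eq]
  calc (∫⁻ y in closedBall x ((2 : ℝ) ^ k), f y ∂μ) / μ (closedBall x ((2 : ℝ) ^ k))
      ≤ (∫⁻ y in closedBall x ((2 : ℝ) ^ k), (g y + c) ∂μ) / μ (closedBall x ((2 : ℝ) ^ k)) := by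
        gcongr
        exact h _
    _ = (∫⁻ y in closedBall x ((2 : ℝ) ^ k), g y ∂μ) / μ (closedBall x ((2 : ℝ) ^ k))
        + c * (μ (closedBall x ((2 : ℝ) ^ k)) / μ (closedBall x ((2 : ℝ) ^ k))) := by
        rw [lintegral_add_right _ measurable_const, ENNReal.add_div, setLIntegral_const,
          mul_div_assoc]
    _ ≤ _ := by
        gcongr
        exact mul_le_of_le_one_right' ENNReal.div_self_le_one

variable {E : Type*} [MetricSpace E] [MeasurableSpace E] [BorelSpace E]
  [SecondCountableTopology E]

theorem measurable_setLIntegral_closedBall (μ : Measure E) [SFinite μ] {f : E → ℝ≥0∞}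
    (hf : Measurable f) (r : ℝ) : Measurable fun x => ∫⁻ y in closedBall x r, f y ∂μ := by
  have h : ∀ x, ∫⁻ y in closedBall x r, f y ∂μ
      = ∫⁻ y, {z : E × E | dist z.2 z.1 ≤ r}.indicator (fun z => f z.2) (x, y) ∂μ := by
    intro x
    rw [← lintegral_indicator measurableSet_closedBall]
    rfl
  simp_rw [h]
  refine Measurable.lintegral_prod_right' (Measurable.indicator (hf.comp measurable_snd) ?_)
  exact measurableSet_le (measurable_snd.dist measurable_fst) measurable_const

theorem measurable_ballMaximal (μ : Measure E) [SFinite μ] {f : E → ℝ≥0∞} (hf : Measurable f) :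
    Measurable (ballMaximal μ f) := by
  refine Measurable.iSup fun k => ?_
  simp_rw [setLAverage_eq]
  refine (measurable_setLIntegral_closedBall μ hf _).div ?_
  simpa using measurable_setLIntegral_closedBall μ (measurable_const (a := (1 : ℝ≥0∞))) ((2 : ℝ) ^ k)

/-- Besicovitch selection: a set of centres of balls with bounded radii, over each of which `f` has
average more than `t`, has small measure. -/
theorem mul_measure_centers_le {N : ℕ} {τ : ℝ} (hτ : 1 < τ)
    (hN : IsEmpty (Besicovitch.SatelliteConfig E N τ)) (μ : Measure E) (f : E → ℝ≥0∞)
    (t : ℝ≥0∞) (R : ℝ) (A : Set E)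
    (hA : ∀ x ∈ A, ∃ r, 0 < r ∧ r ≤ R ∧ t < ⨍⁻ y in closedBall x r, f y ∂μ) :
    t * μ A ≤ N * ∫⁻ x, f x ∂μ := by
  choose! r hr0 hrR hrt using hA
  let q : Besicovitch.BallPackage A E :=
    { c := fun x => x
      r := fun x => r x
      rpos := fun x => hr0 x x.2
      r_bound := R
      r_le := fun x => hrR x x.2 }
  obtain ⟨s, hsd, hsc⟩ := Besicovitch.exist_disjoint_covering_families hτ hN q
  have hcount : ∀ i, (s i).Countable := fun i =>
    (hsd i).countable_of_nonempty_interior fun x _ =>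
      ⟨q.c x, ball_subset_interior_closedBall (mem_ball_self (q.rpos x))⟩
  have hball : ∀ x : A, t * μ (closedBall (q.c x) (q.r x))
      ≤ ∫⁻ y in closedBall (q.c x) (q.r x), f y ∂μ := by
    intro x
    have h := hrt x x.2
    rw [setLAverage_eq] at h
    exact ENNReal.mul_le_of_le_div h.le
  have hfam : ∀ i, t * μ (⋃ x ∈ s i, closedBall (q.c x) (q.r x)) ≤ ∫⁻ x, f x ∂μ := by
    intro i
    have := (hcount i).to_subtype
    calc t * μ (⋃ x ∈ s i, closedBall (q.c x) (q.r x))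
        = ∑' x : s i, t * μ (closedBall (q.c x) (q.r x)) := by
          rw [measure_biUnion (hcount i) (hsd i) fun _ _ => measurableSet_closedBall,
            ENNReal.tsum_mul_left]
      _ ≤ ∑' x : s i, ∫⁻ y in closedBall (q.c x) (q.r x), f y ∂μ :=
          ENNReal.tsum_le_tsum fun x => hball x
      _ = ∫⁻ y in ⋃ x ∈ s i, closedBall (q.c x) (q.r x), f y ∂μ :=
          (lintegral_biUnion (hcount i) (fun _ _ => measurableSet_closedBall) (hsd i) f).symm
      _ ≤ _ := setLIntegral_le_lintegral _ _
  have hcov : A ⊆ ⋃ i, ⋃ x ∈ s i, closedBall (q.c x) (q.r x) := by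
    intro x hx
    have := hsc ⟨⟨x, hx⟩, rfl⟩
    simp only [mem_iUnion] at this ⊢
    obtain ⟨i, j, hj, h⟩ := this
    exact ⟨i, j, hj, ball_subset_closedBall h⟩
  calc t * μ A ≤ t * ∑ i, μ (⋃ x ∈ s i, closedBall (q.c x) (q.r x)) := by
        gcongr
        exact (measure_mono hcov).trans (measure_iUnion_fintype_le _ _)
    _ = ∑ i, t * μ (⋃ x ∈ s i, closedBall (q.c x) (q.r x)) := Finset.mul_sum _ _ _
    _ ≤ ∑ _i : Fin N, ∫⁻ x, f x ∂μ := Finset.sum_le_sum fun i _ => hfam i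
    _ = N * ∫⁻ x, f x ∂μ := by simp

/-- The weak type `(1, 1)` bound, uniform in the measure. -/
theorem exists_weakType_ballMaximal (E : Type*) [MetricSpace E] [MeasurableSpace E] [BorelSpace E]
    [SecondCountableTopology E] [HasBesicovitchCovering E] :
    ∃ N : ℕ, ∀ (μ : Measure E) (f : E → ℝ≥0∞) (t : ℝ≥0∞),
      t * μ {x | t < ballMaximal μ f x} ≤ N * ∫⁻ x, f x ∂μ := by
  obtain ⟨N, τ, hτ, hN⟩ := HasBesicovitchCovering.no_satelliteConfig (α := E)
  refine ⟨N, fun μ f t => ?_⟩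
  -- Besicovitch's theorem needs bounded radii, so they are capped at `2 ^ K`. The capped sets
  -- increase to the level set.
  let A : ℕ → Set E := fun K =>
    {x | ∃ k : ℤ, k ≤ K ∧ t < ⨍⁻ y in closedBall x ((2 : ℝ) ^ k), f y ∂μ}
  have hA : {x | t < ballMaximal μ f x} = ⋃ K, A K := by
    ext x
    simp only [ballMaximal, lt_iSup_iff, mem_ofPred_eq, mem_iUnion, A]
    exact ⟨fun ⟨k, hk⟩ => ⟨k.toNat, k, Int.self_le_toNat k, hk⟩, fun ⟨_, k, _, hk⟩ => ⟨k, hk⟩⟩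
  have hmono : Monotone A := fun K K' h x ⟨k, hk, hx⟩ => ⟨k, hk.trans (by exact_mod_cast h), hx⟩
  rw [hA, hmono.measure_iUnion, ENNReal.mul_iSup]
  refine iSup_le fun K => mul_measure_centers_le hτ hN μ f t ((2 : ℝ) ^ (K : ℤ)) (A K) ?_
  rintro x ⟨k, hk, hx⟩
  exact ⟨2 ^ k, by positivity, zpow_le_zpow_right₀ one_le_two hk, hx⟩

/-- The layer cake formula at a single value, obtained from a Dirac mass. Allowing `y = ∞` lets
Tonelli be applied to functions with infinite values. -/
theorem rpow_eq_lintegral_indicator (y : ℝ≥0∞) {p : ℝ} (hp : 0 < p) :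
    y ^ p = ENNReal.ofReal p * ∫⁻ t in Ioi (0 : ℝ),
      {t : ℝ | ENNReal.ofReal t < y}.indicator (fun t => ENNReal.ofReal (t ^ (p - 1))) t := by
  have hfin : ∀ z : ℝ, 0 ≤ z → ENNReal.ofReal z ^ p = ENNReal.ofReal p * ∫⁻ t in Ioi (0 : ℝ),
      {t : ℝ | ENNReal.ofReal t < ENNReal.ofReal z}.indicator
        (fun t => ENNReal.ofReal (t ^ (p - 1))) t := by
    intro z hz
    have h := lintegral_rpow_eq_lintegral_meas_lt_mul (Measure.dirac ()) (f := fun _ => z)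
      (Filter.Eventually.of_forall fun _ => hz) aemeasurable_const hp
    rw [lintegral_dirac, ← ENNReal.ofReal_rpow_of_nonneg hz hp.le] at h
    rw [h]
    congr 1
    refine setLIntegral_congr_fun measurableSet_Ioi fun t ht => ?_
    by_cases htz : t < z
    · simp [htz, indicator, (ENNReal.ofReal_lt_ofReal_iff_of_nonneg (le_of_lt ht))]
    · simp [htz, indicator, (ENNReal.ofReal_lt_ofReal_iff_of_nonneg (le_of_lt ht))]
  by_cases hy : y = ∞
  · subst hy
    rw [ENNReal.top_rpow_of_pos hp, eq_comm]
    refine ENNReal.eq_top_of_forall_nnreal_le fun r => ?_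
    have h := hfin ((r : ℝ) ^ (1 / p)) (by positivity)
    rw [ENNReal.ofReal_rpow_of_nonneg (by positivity) hp.le, ← Real.rpow_mul r.coe_nonneg,
      one_div_mul_cancel hp.ne', Real.rpow_one, ENNReal.ofReal_coe_nnreal] at h
    rw [h]
    refine mul_le_mul_right (lintegral_mono fun t => ?_) _
    rw [indicator_of_mem (show t ∈ {t : ℝ | ENNReal.ofReal t < ∞} from ENNReal.ofReal_lt_top)]
    exact indicator_apply_le fun _ => le_rfl
  · have := hfin y.toReal ENNReal.toReal_nonneg
    rwa [ENNReal.ofReal_toReal hy] at this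

/-- The interpolation step: a truncated weak type bound gives a strong type bound. -/
theorem lintegral_rpow_le_of_truncated_weakType {α : Type*} [MeasurableSpace α] (μ : Measure α)
    [SFinite μ] {f g : α → ℝ≥0∞} (hf : Measurable f) (hg : Measurable g) (A : ℝ≥0∞)
    (h : ∀ t : ℝ, 0 < t → ENNReal.ofReal t * μ {x | ENNReal.ofReal t < g x}
      ≤ A * ∫⁻ x, {x | ENNReal.ofReal t < 2 * f x}.indicator f x ∂μ)
    {p : ℝ} (hp : 1 < p) :
    ∫⁻ x, g x ^ p ∂μ ≤ ENNReal.ofReal p * A * ((ENNReal.ofReal (p - 1))⁻¹ * 2 ^ (p - 1))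
      * ∫⁻ x, f x ^ p ∂μ := by
  have hp1 : 0 < p - 1 := sub_pos.2 hp
  have hp0 : 0 < p := one_pos.trans hp
  have hpow : ∀ s : ℝ, Measurable fun t : ℝ => ENNReal.ofReal (t ^ s) := fun s => by fun_prop
  have hmeas : ∀ {φ : α → ℝ≥0∞}, Measurable φ → ∀ s : ℝ, Measurable fun z : α × ℝ =>
      {t : ℝ | ENNReal.ofReal t < φ z.1}.indicator (fun t => ENNReal.ofReal (t ^ s)) z.2 := by
    intro φ hφ s
    exact ((hpow s).comp measurable_snd).indicator (s := {z : α × ℝ | ENNReal.ofReal z.2 < φ z.1})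
      (measurableSet_lt (ENNReal.measurable_ofReal.comp measurable_snd) (hφ.comp measurable_fst))
  calc ∫⁻ x, g x ^ p ∂μ
      = ENNReal.ofReal p * ∫⁻ t in Ioi (0 : ℝ), ∫⁻ x,
          {t : ℝ | ENNReal.ofReal t < g x}.indicator
            (fun t => ENNReal.ofReal (t ^ (p - 1))) t ∂μ := by
        simp_rw [fun x => rpow_eq_lintegral_indicator (g x) hp0]
        rw [lintegral_const_mul' _ _ ENNReal.ofReal_ne_top,
          lintegral_lintegral_swap (hmeas hg _).aemeasurable]
    _ ≤ ENNReal.ofReal p * ∫⁻ t in Ioi (0 : ℝ), A * ∫⁻ x, f x *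
          {t : ℝ | ENNReal.ofReal t < 2 * f x}.indicator
            (fun t => ENNReal.ofReal (t ^ (p - 1 - 1))) t ∂μ := by
        gcongr ENNReal.ofReal p * ?_
        refine setLIntegral_mono' measurableSet_Ioi fun t (ht : 0 < t) => ?_
        have h1 : ∀ x, {t : ℝ | ENNReal.ofReal t < g x}.indicator
            (fun t => ENNReal.ofReal (t ^ (p - 1))) t
            = {x | ENNReal.ofReal t < g x}.indicator
              (fun _ => ENNReal.ofReal (t ^ (p - 1))) x := fun x => rfl
        have h2 : ∀ x, f x * {t : ℝ | ENNReal.ofReal t < 2 * f x}.indicator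
            (fun t => ENNReal.ofReal (t ^ (p - 1 - 1))) t
            = ENNReal.ofReal (t ^ (p - 1 - 1)) *
              {x | ENNReal.ofReal t < 2 * f x}.indicator f x := by
          intro x
          simp only [indicator, mem_ofPred_eq]
          split_ifs <;> simp [mul_comm]
        simp_rw [h1, h2]
        rw [lintegral_indicator (measurableSet_lt measurable_const hg), setLIntegral_const,
          lintegral_const_mul' _ _ ENNReal.ofReal_ne_top, mul_left_comm]
        have h3 : ENNReal.ofReal (t ^ (p - 1))
            = ENNReal.ofReal (t ^ (p - 1 - 1)) * ENNReal.ofReal t := by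
          rw [← ENNReal.ofReal_mul (by positivity)]
          congr 1
          rw [Real.rpow_sub_one ht.ne' (p - 1), div_mul_cancel₀ _ ht.ne']
        rw [h3, mul_assoc]
        exact mul_le_mul_right (h t ht) _
    -- After Tonelli, the integral of `t ^ (p - 2)` over `0 < t < 2 f` is `(2 f) ^ (p - 1) / (p -
    -- 1)`; here `p > 1` is needed.
    _ = ENNReal.ofReal p * (A * ∫⁻ x, f x * ((ENNReal.ofReal (p - 1))⁻¹ *
          (2 * f x) ^ (p - 1)) ∂μ) := by
        have hm : Measurable fun z : α × ℝ => f z.1 *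
            {t : ℝ | ENNReal.ofReal t < 2 * f z.1}.indicator
              (fun t => ENNReal.ofReal (t ^ (p - 1 - 1))) z.2 :=
          (hf.comp measurable_fst).mul (hmeas (hf.const_mul 2) _)
        rw [lintegral_const_mul _ (hm.lintegral_prod_left'), ← lintegral_lintegral_swap
          (f := fun x t => f x * {t : ℝ | ENNReal.ofReal t < 2 * f x}.indicator
              (fun t => ENNReal.ofReal (t ^ (p - 1 - 1))) t) hm.aemeasurable]
        congr 3
        funext x
        have hx : Measurable ({t : ℝ | ENNReal.ofReal t < 2 * f x}.indicator
            fun t => ENNReal.ofReal (t ^ (p - 1 - 1))) :=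
          (hmeas (hf.const_mul 2) (p - 1 - 1)).comp measurable_prodMk_left
        rw [lintegral_const_mul _ hx,
          rpow_eq_lintegral_indicator (2 * f x) hp1, ← mul_assoc (ENNReal.ofReal (p - 1))⁻¹,
          ENNReal.inv_mul_cancel (by simpa using hp) ENNReal.ofReal_ne_top, one_mul]
    _ = _ := by
        have h4 : ∀ x, f x * ((ENNReal.ofReal (p - 1))⁻¹ * (2 * f x) ^ (p - 1))
            = (ENNReal.ofReal (p - 1))⁻¹ * 2 ^ (p - 1) * f x ^ p := by
          intro x
          have : f x ^ p = f x * f x ^ (p - 1) := by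
            conv_lhs => rw [show p = 1 + (p - 1) by ring,
              ENNReal.rpow_add_of_nonneg _ _ zero_le_one hp1.le, ENNReal.rpow_one]
          rw [this, ENNReal.mul_rpow_of_nonneg _ _ hp1.le]
          ring
        simp_rw [h4]
        rw [lintegral_const_mul _ (hf.pow_const p)]
        ring

/-- The strong type `(p, p)` bound for `1 < p`, uniform in the measure. -/
theorem exists_strongType_ballMaximal (E : Type*) [MetricSpace E] [MeasurableSpace E]
    [BorelSpace E] [SecondCountableTopology E] [HasBesicovitchCovering E] {p : ℝ} (hp : 1 < p) :
    ∃ C : ℝ≥0∞, C ≠ ∞ ∧ ∀ (μ : Measure E) [SFinite μ] (f : E → ℝ≥0∞), Measurable f →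
      ∫⁻ x, ballMaximal μ f x ^ p ∂μ ≤ C * ∫⁻ x, f x ^ p ∂μ := by
  obtain ⟨N, hN⟩ := exists_weakType_ballMaximal E
  refine ⟨_, ?_, fun μ _ f hf => lintegral_rpow_le_of_truncated_weakType μ hf
    (measurable_ballMaximal μ hf) (2 * N) (fun t ht => ?_) hp⟩
  · have : ENNReal.ofReal (p - 1) ≠ 0 := by simpa using hp
    have h2 : (2 : ℝ≥0∞) ^ (p - 1) ≠ ∞ := ENNReal.rpow_ne_top_of_nonneg (by linarith) (by simp)
    finiteness
  set T := ENNReal.ofReal t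
  -- The discarded part of `f` is at most `T / 2`, so `f₁` must account for the other half of the
  -- level `T`. Halving the level gives the 2 in `2 * N`.
  set f₁ := {x | T < 2 * f x}.indicator f
  have h1 : {x | T < ballMaximal μ f x} ⊆ {x | T / 2 < ballMaximal μ f₁ x} := by
    intro x hx
    by_contra hcon
    have h2 := ballMaximal_le_add μ (f := f) (g := f₁) (T / 2) (fun y => ?_) x
    · have h3 : ballMaximal μ f x ≤ T / 2 + T / 2 :=
        h2.trans (by gcongr; exact not_lt.1 hcon)
      rw [ENNReal.add_halves] at h3
      exact absurd hx (not_lt.2 h3)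
    · by_cases hy : T < 2 * f y
      · simp [f₁, hy]
      · rw [not_lt] at hy
        refine le_add_left ((ENNReal.le_div_iff_mul_le (by simp) (by simp)).2 ?_)
        rwa [mul_comm]
  calc T * μ {x | T < ballMaximal μ f x}
      ≤ (2 * (T / 2)) * μ {x | T / 2 < ballMaximal μ f₁ x} := by
        rw [ENNReal.mul_div_cancel (by simp) (by simp)]
        gcongr
    _ ≤ 2 * (N * ∫⁻ x, f₁ x ∂μ) := by
        rw [mul_assoc]
        exact mul_le_mul_right (hN μ f₁ _) _
    _ = _ := by rw [mul_assoc]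

end BallMaximal

/-! ### The multilinear maximal function of order zero. -/

section MultilinearMaximal

open Metric Set

theorem prod_rpow_eq_rpow_sum {ι : Type*} {a : ℝ≥0∞} (h0 : a ≠ 0) (h : a ≠ ∞) (s : Finset ι) (f : ι → ℝ) :
    ∏ i ∈ s, a ^ f i = a ^ ∑ i ∈ s, f i := by
  classical
  induction s using Finset.induction_on with
  | empty => simp
  | insert i s hi ih => rw [Finset.prod_insert hi, Finset.sum_insert hi, ENNReal.rpow_add _ _ h0 h, ih]

variable {ι : Type*} [Fintype ι]

/-- Splits the power `θ` off every `1 - e i`, leaving nonnegative exponents. It serves for the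
densities pointwise and again for their means. -/
theorem rpow_mul_prod_rpow_eq (U : ℝ≥0∞) (S : ι → ℝ≥0∞) {e : ι → ℝ} {E θ l : ℝ}
    (hE : 0 < E) (hθ : 0 < θ) (hθe : ∀ i, θ ≤ 1 - e i) (hl : 0 ≤ l) :
    (U ^ E * ∏ i, S i ^ (1 - e i)) ^ l
      = (U * ∏ i, S i ^ (θ / E)) ^ (l * E) * ∏ i, S i ^ (l * (1 - e i - θ)) := by
  rw [ENNReal.mul_rpow_of_nonneg _ _ hl, ENNReal.mul_rpow_of_nonneg _ _ (by positivity),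
    ← ENNReal.rpow_mul, mul_comm E l, mul_assoc, ← ENNReal.prod_rpow_of_nonneg hl,
    ← ENNReal.prod_rpow_of_nonneg (by positivity : 0 ≤ l * E), ← Finset.prod_mul_distrib]
  congr 1
  refine Finset.prod_congr rfl fun i _ => ?_
  have := hθe i
  rw [← ENNReal.rpow_mul, ← ENNReal.rpow_mul,
    ← ENNReal.rpow_add_of_nonneg _ _ (by positivity) (mul_nonneg hl (by linarith))]
  congr 1
  field_simp
  ring

/-- A reverse Jensen inequality: if Hölder's inequality for `u ^ E` and `σ i ^ (1 - e i)`, whose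
product is one, can be reversed up to the constant `K`, so can the inequality between the mean of
`u * ∏ i, σ i ^ (θ / E)` and the product of the means. -/
theorem mul_prod_rpow_le_lintegral [Nonempty ι] {α : Type*} [MeasurableSpace α] (ν : Measure α)
    [IsProbabilityMeasure ν] {u : α → ℝ≥0∞} {σ : ι → α → ℝ≥0∞} (hu : Measurable u)
    (hσ : ∀ i, Measurable (σ i)) {e : ι → ℝ} {θ : ℝ} (he : ∀ i, 0 < e i)
    (hθ : 0 < θ) (hθ1 : θ < 1) (hθe : ∀ i, θ ≤ 1 - e i)
    (h1 : ∀ᵐ x ∂ν, u x ^ (∑ i, e i) * ∏ i, σ i x ^ (1 - e i) = 1)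
    {S : ι → ℝ≥0∞} (hS0 : ∀ i, S i ≠ 0) (hS : ∀ i, S i ≠ ∞) (hσS : ∀ i, ∫⁻ x, σ i x ∂ν ≤ S i)
    {K : ℝ≥0∞} (hK : (∫⁻ x, u x ∂ν) ^ (∑ i, e i) * ∏ i, S i ^ (1 - e i) ≤ K) :
    (∫⁻ x, u x ∂ν) * ∏ i, S i ^ (θ / ∑ i, e i)
      ≤ K ^ (1 / ∑ i, e i) * ∫⁻ x, u x * ∏ i, σ i x ^ (θ / ∑ i, e i) ∂ν := by
  set E := ∑ i, e i
  have hE : 0 < E := Finset.sum_pos (fun i _ => he i) Finset.univ_nonempty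
  set m : ℝ := (Fintype.card ι : ℝ)
  have hm : 0 < m := by simp only [m]; exact_mod_cast Fintype.card_pos
  -- This normalises the Hölder exponents: `l E + ∑ l (1 - e i - θ) = l m (1 - θ) = 1`.
  set l : ℝ := 1 / (m * (1 - θ))
  have hl : 0 < l := by have := sub_pos.2 hθ1; positivity
  set X := ∫⁻ x, u x * ∏ i, σ i x ^ (θ / E) ∂ν
  have hc : ∀ i, 0 ≤ l * (1 - e i - θ) := fun i => mul_nonneg hl.le (by linarith [hθe i])
  have hsum : l * E + ∑ i, l * (1 - e i - θ) = 1 := by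
    rw [← Finset.mul_sum, Finset.sum_sub_distrib, Finset.sum_sub_distrib]
    simp only [Finset.sum_const, Finset.card_univ, nsmul_eq_mul]
    have h1θ : 1 - θ ≠ 0 := (sub_pos.2 hθ1).ne'
    change l * E + l * (m * 1 - E - m * θ) = 1
    simp only [l]
    field_simp
    ring
  have hX : 1 ≤ X ^ (l * E) * ∏ i, S i ^ (l * (1 - e i - θ)) :=
    calc (1 : ℝ≥0∞) = ∫⁻ x, (u x ^ E * ∏ i, σ i x ^ (1 - e i)) ^ l ∂ν := by
          rw [lintegral_congr_ae (g := fun _ => 1) (by filter_upwards [h1] with x hx; simp [hx])]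
          simp
      _ = ∫⁻ x, (u x * ∏ i, σ i x ^ (θ / E)) ^ (l * E)
            * ∏ i, σ i x ^ (l * (1 - e i - θ)) ∂ν :=
          lintegral_congr fun x => rpow_mul_prod_rpow_eq _ _ hE hθ hθe hl.le
      _ ≤ X ^ (l * E) * ∏ i, (∫⁻ x, σ i x ∂ν) ^ (l * (1 - e i - θ)) :=
          ENNReal.lintegral_mul_prod_norm_pow_le _
            (hu.mul (Finset.measurable_fun_prod _ fun i _ => (hσ i).pow_const _)).aemeasurable
            (fun i _ => (hσ i).aemeasurable) _ hsum (by positivity) fun i _ => hc i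
      _ ≤ _ := by
          gcongr with i
          · exact hc i
          · exact hσS i
  set P := ∏ i, S i ^ (l * (1 - e i - θ))
  have hP0 : P ≠ 0 := Finset.prod_ne_zero_iff.2 fun i _ =>
    (ENNReal.rpow_pos (pos_iff_ne_zero.2 (hS0 i)) (hS i)).ne'
  have hP : P ≠ ∞ := ENNReal.prod_ne_top fun i _ => ENNReal.rpow_ne_top_of_nonneg (hc i) (hS i)
  have hmain : ((∫⁻ x, u x ∂ν) * ∏ i, S i ^ (θ / E)) ^ (l * E)
      ≤ (K ^ (1 / E) * X) ^ (l * E) := by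
    have hKl : (K ^ (1 / E)) ^ (l * E) = K ^ l := by
      rw [← ENNReal.rpow_mul, show 1 / E * (l * E) = l by field_simp]
    -- Multiplication by `P` turns the left side into the `l`-th power of the quantity in `hK`,
    -- while `hX` says `1 ≤ X ^ (l * E) * P`.
    rw [← ENNReal.mul_le_mul_iff_left hP0 hP, ← rpow_mul_prod_rpow_eq _ _ hE hθ hθe hl.le,
      ENNReal.mul_rpow_of_nonneg (K ^ (1 / E)) X (by positivity), hKl, mul_assoc]
    exact (ENNReal.rpow_le_rpow hK hl.le).trans (le_mul_of_one_le_right' hX)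
  exact (ENNReal.rpow_le_rpow_iff (by positivity)).1 hmain

variable {n : ℕ}

theorem volume_closedBall_three_mul (x : Fin n → ℝ) {r : ℝ} (hr : 0 < r) :
    volume (closedBall x (3 * r)) = 3 ^ n * volume (closedBall x r) := by
  rw [Real.volume_pi_closedBall _ hr.le, Real.volume_pi_closedBall _ (by positivity)]
  rw [show (2 * (3 * r)) = 3 * (2 * r) by ring, mul_pow, ENNReal.ofReal_mul (by positivity)]
  simp

/-- The multilinear maximal function with densities `σ`, over centred balls with dyadic radius. -/
noncomputable def multiMaximal (σ h : ι → (Fin n → ℝ) → ℝ≥0∞) (x : Fin n → ℝ) : ℝ≥0∞ :=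
  ⨆ k : ℤ, ∏ i, ⨍⁻ y in closedBall x ((2 : ℝ) ^ k), h i y * σ i y ∂volume

/-- Since `B(x, 2^k) ⊆ B(y, 2^(k+1)) ⊆ B(x, 3·2^k)`, the left side is at most the `σ`-average of `h`
over the middle ball. It does not depend on `y`, so it may later be moved under an integral over the
ball. -/
theorem setLIntegral_div_le_ballMaximal {σ h : (Fin n → ℝ) → ℝ≥0∞}
    (hσm : Measurable σ) (hh : Measurable h) {x y : Fin n → ℝ} {k : ℤ}
    (hy : y ∈ closedBall x ((2 : ℝ) ^ k)) :
    (∫⁻ z in closedBall x ((2 : ℝ) ^ k), h z * σ z) / ∫⁻ z in closedBall x (3 * 2 ^ k), σ z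
      ≤ ballMaximal (volume.withDensity σ) h y := by
  refine le_trans ?_ (setLAverage_le_ballMaximal _ _ _ (k + 1))
  have h2 : (2 : ℝ) ^ (k + 1) = 2 ^ k + 2 ^ k := by rw [zpow_add_one₀ two_ne_zero]; ring
  rw [mem_closedBall] at hy
  rw [setLAverage_eq, withDensity_apply _ measurableSet_closedBall,
    setLIntegral_withDensity_eq_setLIntegral_mul _ hσm hh measurableSet_closedBall]
  simp only [Pi.mul_apply, mul_comm (σ _)]
  refine ENNReal.div_le_div (lintegral_mono_set ?_) (lintegral_mono_set ?_)
  · exact closedBall_subset_closedBall' (by rw [dist_comm, h2]; linarith)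
  · exact closedBall_subset_closedBall' (by rw [h2]; linarith)

/-- Each mean of `h i * σ i` factors as `S i * A i`, with `A i` below the maximal function of `h i`
throughout the ball. Reverse Jensen replaces `U * ∏ S i ^ (θ / E)` by the mean of `u * ∏ σ i ^ (θ /
E)`, and the `A i` then go inside the integral. -/
theorem prod_setLAverage_rpow_le [Nonempty ι] {u : (Fin n → ℝ) → ℝ≥0∞}
    {σ h : ι → (Fin n → ℝ) → ℝ≥0∞} (hu : Measurable u)
    (hσ : ∀ i, Measurable (σ i)) (hh : ∀ i, Measurable (h i)) {e : ι → ℝ} {θ : ℝ}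
    (he : ∀ i, 0 < e i) (hθ : 0 < θ) (hθ1 : θ < 1) (hθe : ∀ i, θ ≤ 1 - e i)
    (h1 : ∀ᵐ x, u x ^ (∑ i, e i) * ∏ i, σ i x ^ (1 - e i) = 1)
    (hu0 : ∀ᵐ x, u x ≠ 0) (hσ0 : ∀ i, ∀ᵐ x, σ i x ≠ 0)
    (hufin : ∀ x : Fin n → ℝ, ∀ r : ℝ, ∫⁻ y in closedBall x r, u y ≠ ∞)
    (hσfin : ∀ i, ∀ x : Fin n → ℝ, ∀ r : ℝ, ∫⁻ y in closedBall x r, σ i y ≠ ∞)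
    {K : ℝ≥0∞} (hK : ∀ x : Fin n → ℝ, ∀ r : ℝ, 0 < r →
      (⨍⁻ y in closedBall x r, u y ∂volume) ^ (∑ i, e i)
        * ∏ i, (⨍⁻ y in closedBall x r, σ i y ∂volume) ^ (1 - e i) ≤ K)
    (x : Fin n → ℝ) :
    multiMaximal σ h x ^ (θ / ∑ i, e i)
      ≤ ((3 ^ n) ^ (Fintype.card ι : ℝ) * K) ^ (1 / ∑ i, e i) * ballMaximal (volume.withDensity u)
        (fun y => (∏ i, σ i y * ballMaximal (volume.withDensity (σ i)) (h i) y)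
          ^ (θ / ∑ i, e i)) x := by
  set E := ∑ i, e i
  have hE : 0 < E := Finset.sum_pos (fun i _ => he i) Finset.univ_nonempty
  have hδ : 0 < θ / E := by positivity
  rw [← ENNReal.le_rpow_inv_iff hδ]
  refine iSup_le fun k => ?_
  rw [ENNReal.le_rpow_inv_iff hδ]
  have hr : (0 : ℝ) < 2 ^ k := by positivity
  set r : ℝ := 2 ^ k
  set B := closedBall x r
  have hpos : ∀ {φ : (Fin n → ℝ) → ℝ≥0∞}, Measurable φ → (∀ᵐ x, φ x ≠ 0) → ∀ {s : ℝ}, 0 < s →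
      ∫⁻ y in closedBall x s, φ y ≠ 0 := by
    intro φ hφ h0 s hs hcon
    rw [lintegral_eq_zero_iff hφ] at hcon
    have : ∀ᵐ _y ∂volume.restrict (closedBall x s), False := by
      filter_upwards [hcon, ae_restrict_of_ae h0] with y hy hy0 using hy0 hy
    rw [Filter.eventually_false_iff_eq_bot, ae_eq_bot, Measure.restrict_eq_zero] at this
    exact (measure_closedBall_pos volume x hs).ne' this
  have hB0 : volume B ≠ 0 := (measure_closedBall_pos volume x hr).ne'
  have hB : volume B ≠ ∞ := measure_closedBall_lt_top.ne
  set ν : Measure (Fin n → ℝ) := (volume B)⁻¹ • volume.restrict B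
  have hν : IsProbabilityMeasure ν := ⟨by simp [ν, ENNReal.inv_mul_cancel hB0 hB]⟩
  have hνint : ∀ φ : (Fin n → ℝ) → ℝ≥0∞, ∫⁻ y, φ y ∂ν = (∫⁻ y in B, φ y) / volume B := by
    intro φ
    rw [lintegral_smul_measure, smul_eq_mul, ENNReal.div_eq_inv_mul]
  have hνac : ν ≪ volume := (Measure.absolutelyContinuous_of_le Measure.restrict_le_self).smul_left _
  set V : ι → ℝ≥0∞ := fun i => ∫⁻ y in closedBall x (3 * r), σ i y
  have hV0 : ∀ i, V i ≠ 0 := fun i => hpos (hσ i) (hσ0 i) (by positivity)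
  have hV : ∀ i, V i ≠ ∞ := fun i => hσfin i _ _
  set A : ι → ℝ≥0∞ := fun i => (∫⁻ y in B, h i y * σ i y) / V i
  set S : ι → ℝ≥0∞ := fun i => V i / volume B
  have hsub : B ⊆ closedBall x (3 * r) := closedBall_subset_closedBall (by linarith)
  have hS0 : ∀ i, S i ≠ 0 := fun i => (ENNReal.div_pos (hV0 i) hB).ne'
  have hS : ∀ i, S i ≠ ∞ := fun i => ENNReal.div_ne_top (hV i) hB0
  have hSA : ∀ i, ⨍⁻ y in B, h i y * σ i y ∂volume = S i * A i := by
    intro i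
    rw [setLAverage_eq]
    simp only [S, A]
    rw [mul_comm, ← mul_div_assoc, ENNReal.div_mul_cancel (hV0 i) (hV i)]
  set U := ∫⁻ y, u y ∂ν
  have hU0 : U ≠ 0 := by
    change ∫⁻ y, u y ∂ν ≠ 0
    rw [hνint]; exact (ENNReal.div_pos (hpos hu hu0 hr) hB).ne'
  have hU : U ≠ ∞ := by
    change ∫⁻ y, u y ∂ν ≠ ∞
    rw [hνint]; exact ENNReal.div_ne_top (hufin _ _) hB0
  have h3 : ∀ a : ℝ≥0∞, a / volume B = 3 ^ n * (a / volume (closedBall x (3 * r))) := by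
    intro a
    rw [volume_closedBall_three_mul x hr, ← mul_div_assoc,
      ENNReal.mul_div_mul_left _ _ (by simp) (by finiteness)]
  -- The condition is applied on the tripled ball. The exponents `E` and `1 - e i` of `3 ^ n` add up
  -- to the number of indices.
  have hUS : U ^ E * ∏ i, S i ^ (1 - e i) ≤ (3 ^ n) ^ (Fintype.card ι : ℝ) * K := by
    have he1 : ∀ i, 0 ≤ 1 - e i := fun i => hθ.le.trans (hθe i)
    calc U ^ E * ∏ i, S i ^ (1 - e i)
        ≤ (3 ^ n * ⨍⁻ y in closedBall x (3 * r), u y ∂volume) ^ E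
          * ∏ i, (3 ^ n * ⨍⁻ y in closedBall x (3 * r), σ i y ∂volume) ^ (1 - e i) := by
          simp only [hνint, U, S, V, setLAverage_eq, h3]
          gcongr
      _ = (3 ^ n) ^ (Fintype.card ι : ℝ) * ((⨍⁻ y in closedBall x (3 * r), u y ∂volume) ^ E
          * ∏ i, (⨍⁻ y in closedBall x (3 * r), σ i y ∂volume) ^ (1 - e i)) := by
          simp_rw [ENNReal.mul_rpow_of_nonneg _ _ hE.le, fun i => ENNReal.mul_rpow_of_nonneg
            (3 ^ n) (⨍⁻ y in closedBall x (3 * r), σ i y ∂volume) (he1 i)]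
          rw [Finset.prod_mul_distrib, mul_mul_mul_comm]
          congr 1
          have h3n : (3 : ℝ≥0∞) ^ n ≠ ∞ := by finiteness
          rw [prod_rpow_eq_rpow_sum (by simp) h3n, ← ENNReal.rpow_add _ _ (by simp) h3n,
            Finset.sum_sub_distrib]
          congr 1
          simp [E]
      _ ≤ _ := by gcongr; exact hK x _ (by positivity)
  have hkey := mul_prod_rpow_le_lintegral ν hu hσ he hθ hθ1 hθe (hνac.ae_le h1) hS0 hS
    (fun i => by rw [hνint]; exact ENNReal.div_le_div_right (lintegral_mono_set hsub) _) hUS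
  set K' := ((3 ^ n) ^ (Fintype.card ι : ℝ) * K) ^ (1 / E)
  set M : (Fin n → ℝ) → ℝ≥0∞ := fun y =>
    ∏ i, σ i y * ballMaximal (volume.withDensity (σ i)) (h i) y
  have hMm : Measurable M := Finset.measurable_fun_prod _ fun i _ =>
    (hσ i).mul (measurable_ballMaximal _ (hh i))
  have hX : Measurable fun y => u y * ∏ i, σ i y ^ (θ / E) :=
    hu.mul (Finset.measurable_fun_prod _ fun i _ => (hσ i).pow_const _)
  have hXA : (∫⁻ y, u y * ∏ i, σ i y ^ (θ / E) ∂ν) * ∏ i, A i ^ (θ / E)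
      ≤ U * ballMaximal (volume.withDensity u) (fun y => M y ^ (θ / E)) x := by
    calc (∫⁻ y, u y * ∏ i, σ i y ^ (θ / E) ∂ν) * ∏ i, A i ^ (θ / E)
        = ((∫⁻ y in B, (u y * ∏ i, σ i y ^ (θ / E)) * ∏ i, A i ^ (θ / E))) / volume B := by
          rw [← hνint, lintegral_mul_const _ hX]
      _ ≤ (∫⁻ y in B, u y * M y ^ (θ / E)) / volume B := by
          refine ENNReal.div_le_div_right (setLIntegral_mono' measurableSet_closedBall
            fun y hy => ?_) _
          rw [mul_assoc, ← Finset.prod_mul_distrib, ← ENNReal.prod_rpow_of_nonneg hδ.le]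
          gcongr with i
          rw [← ENNReal.mul_rpow_of_nonneg _ _ hδ.le]
          gcongr
          exact setLIntegral_div_le_ballMaximal (hσ i) (hh i) hy
      _ = U * ⨍⁻ y in B, M y ^ (θ / E) ∂volume.withDensity u := by
          rw [setLAverage_eq, withDensity_apply _ measurableSet_closedBall,
            setLIntegral_withDensity_eq_setLIntegral_mul _ hu (hMm.pow_const _)
              measurableSet_closedBall]
          simp only [Pi.mul_apply, U, hνint]
          rw [mul_comm, ← mul_div_assoc,
            ENNReal.div_mul_cancel (hpos hu hu0 hr) (hufin _ _)]
      _ ≤ _ := by gcongr; exact setLAverage_le_ballMaximal _ _ _ _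
  rw [← ENNReal.mul_le_mul_iff_right hU0 hU]
  calc U * (∏ i, ⨍⁻ y in B, h i y * σ i y ∂volume) ^ (θ / E)
      = (U * ∏ i, S i ^ (θ / E)) * ∏ i, A i ^ (θ / E) := by
        simp_rw [hSA]
        rw [Finset.prod_mul_distrib, ENNReal.mul_rpow_of_nonneg _ _ hδ.le,
          ENNReal.prod_rpow_of_nonneg hδ.le, ENNReal.prod_rpow_of_nonneg hδ.le, mul_assoc]
    _ ≤ (K' * ∫⁻ y, u y * ∏ i, σ i y ^ (θ / E) ∂ν) * ∏ i, A i ^ (θ / E) := by gcongr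
    _ ≤ K' * (U * ballMaximal (volume.withDensity u) (fun y => M y ^ (θ / E)) x) := by
        rw [mul_assoc]; gcongr
    _ = _ := by ring

/-- The weighted bound for the multilinear maximal function. -/
theorem exists_lintegral_multiMaximal_le [Nonempty ι] {u : (Fin n → ℝ) → ℝ≥0∞}
    {σ : ι → (Fin n → ℝ) → ℝ≥0∞} (hu : Measurable u) (hσ : ∀ i, Measurable (σ i))
    {e : ι → ℝ} (he : ∀ i, 0 < e i) (he1 : ∀ i, e i < 1)
    (h1 : ∀ᵐ x, u x ^ (∑ i, e i) * ∏ i, σ i x ^ (1 - e i) = 1)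
    (hu0 : ∀ᵐ x, u x ≠ 0) (hσ0 : ∀ i, ∀ᵐ x, σ i x ≠ 0)
    (hufin : ∀ x : Fin n → ℝ, ∀ r : ℝ, ∫⁻ y in closedBall x r, u y ≠ ∞)
    (hσfin : ∀ i, ∀ x : Fin n → ℝ, ∀ r : ℝ, ∫⁻ y in closedBall x r, σ i y ≠ ∞)
    {K : ℝ≥0∞} (hKfin : K ≠ ∞) (hK : ∀ x : Fin n → ℝ, ∀ r : ℝ, 0 < r →
      (⨍⁻ y in closedBall x r, u y ∂volume) ^ (∑ i, e i)
        * ∏ i, (⨍⁻ y in closedBall x r, σ i y ∂volume) ^ (1 - e i) ≤ K) :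
    ∃ C : ℝ≥0∞, C ≠ ∞ ∧ ∀ h : ι → (Fin n → ℝ) → ℝ≥0∞, (∀ i, Measurable (h i)) →
      ∫⁻ x, multiMaximal σ h x ^ (1 / ∑ i, e i) * u x
        ≤ C * ∏ i, (∫⁻ x, h i x ^ (1 / e i) * σ i x) ^ (e i / ∑ i, e i) := by
  set E := ∑ i, e i
  have hE : 0 < E := Finset.sum_pos (fun i _ => he i) Finset.univ_nonempty
  obtain ⟨i₀, -, hi₀⟩ := Finset.exists_max_image Finset.univ e Finset.univ_nonempty
  -- The minimum of the `1 - e i`: reverse Jensen allows nothing larger, and `0 < θ < 1` makes `1 /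
  -- θ` an admissible exponent.
  set θ := 1 - e i₀
  have hθ : 0 < θ := sub_pos.2 (he1 i₀)
  have hθ1 : θ < 1 := by linarith [he i₀]
  have hθe : ∀ i, θ ≤ 1 - e i := fun i => sub_le_sub_left (hi₀ i (Finset.mem_univ i)) 1
  obtain ⟨D, hD, hDM⟩ := exists_strongType_ballMaximal (Fin n → ℝ) (one_lt_one_div hθ hθ1)
  choose D' hD' hDM' using fun i =>
    exists_strongType_ballMaximal (Fin n → ℝ) (one_lt_one_div (he i) (he1 i))
  set K' : ℝ≥0∞ := ((3 ^ n) ^ (Fintype.card ι : ℝ) * K) ^ (1 / E)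
  have hK' : K' ≠ ∞ := by
    refine ENNReal.rpow_ne_top_of_nonneg (by positivity) (ENNReal.mul_ne_top ?_ hKfin)
    exact ENNReal.rpow_ne_top_of_nonneg (by positivity) (by finiteness)
  have heE : ∀ i, 0 ≤ e i / E := fun i => div_nonneg (he i).le hE.le
  refine ⟨K' ^ (1 / θ) * (D * ∏ i, D' i ^ (e i / E)), ?_, fun h hh => ?_⟩
  · refine ENNReal.mul_ne_top (ENNReal.rpow_ne_top_of_nonneg (by positivity) hK')
      (ENNReal.mul_ne_top hD (ENNReal.prod_ne_top fun i _ =>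
        ENNReal.rpow_ne_top_of_nonneg (heE i) (hD' i)))
  set N : ι → (Fin n → ℝ) → ℝ≥0∞ := fun i => ballMaximal (volume.withDensity (σ i)) (h i)
  have hN : ∀ i, Measurable (N i) := fun i => measurable_ballMaximal _ (hh i)
  set M : (Fin n → ℝ) → ℝ≥0∞ := fun y => ∏ i, σ i y * N i y
  have hM : Measurable M := Finset.measurable_fun_prod _ fun i _ => (hσ i).mul (hN i)
  set F : (Fin n → ℝ) → ℝ≥0∞ := ballMaximal (volume.withDensity u) (fun y => M y ^ (θ / E))
  have hF : Measurable F := measurable_ballMaximal _ (hM.pow_const _)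
  have hpt : ∀ x, multiMaximal σ h x ^ (1 / E) ≤ K' ^ (1 / θ) * F x ^ (1 / θ) := by
    intro x
    rw [← ENNReal.mul_rpow_of_nonneg _ _ (by positivity),
      show 1 / E = θ / E * (1 / θ) by field_simp, ENNReal.rpow_mul]
    exact ENNReal.rpow_le_rpow (prod_setLAverage_rpow_le hu hσ hh he hθ hθ1 hθe h1 hu0 hσ0 hufin
      hσfin hK x) (by positivity)
  calc ∫⁻ x, multiMaximal σ h x ^ (1 / E) * u x
      ≤ ∫⁻ x, K' ^ (1 / θ) * (F x ^ (1 / θ) * u x) := by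
        refine lintegral_mono fun x => ?_
        rw [← mul_assoc]
        exact mul_le_mul_left (hpt x) _
    _ = K' ^ (1 / θ) * ∫⁻ x, F x ^ (1 / θ) ∂volume.withDensity u := by
        have hFu : Measurable fun x => F x ^ (1 / θ) * u x := (hF.pow_const _).mul hu
        rw [lintegral_const_mul _ hFu,
          lintegral_withDensity_eq_lintegral_mul _ hu (hF.pow_const _)]
        simp only [Pi.mul_apply, mul_comm]
    _ ≤ K' ^ (1 / θ) * (D * ∫⁻ x, (M x ^ (θ / E)) ^ (1 / θ) ∂volume.withDensity u) := by
        gcongr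
        exact hDM _ _ (hM.pow_const _)
    _ = K' ^ (1 / θ) * (D * ∫⁻ x, ∏ i, (N i x ^ (1 / e i) * σ i x) ^ (e i / E)) := by
        rw [lintegral_withDensity_eq_lintegral_mul _ hu ((hM.pow_const _).pow_const _)]
        congr 2
        refine lintegral_congr_ae ?_
        filter_upwards [h1] with x hx
        -- This identity absorbs `u`, leaving `σ i ^ (e i / E)` out of `σ i ^ (1 / E)`: what Hölder
        -- with exponents `e i / E` needs.
        have h2 : u x * ∏ i, σ i x ^ ((1 - e i) * (1 / E)) = 1 := by
          have := congrArg (· ^ (1 / E)) hx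
          simp only [ENNReal.one_rpow] at this
          rwa [ENNReal.mul_rpow_of_nonneg _ _ (by positivity), ← ENNReal.rpow_mul,
            mul_one_div_cancel hE.ne', ENNReal.rpow_one,
            ← ENNReal.prod_rpow_of_nonneg (by positivity), Finset.prod_congr rfl
              fun i _ => (ENNReal.rpow_mul (σ i x) (1 - e i) (1 / E)).symm] at this
        have h3 : ∀ i, σ i x ^ (1 / E) = σ i x ^ ((1 - e i) * (1 / E)) * σ i x ^ (e i / E) := by
          intro i
          rw [← ENNReal.rpow_add_of_nonneg _ _ (mul_nonneg (by linarith [he1 i]) (by positivity))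
            (heE i)]
          congr 1
          ring
        simp only [Pi.mul_apply]
        rw [← ENNReal.rpow_mul, show θ / E * (1 / θ) = 1 / E by field_simp,
          ← ENNReal.prod_rpow_of_nonneg (by positivity)]
        calc u x * ∏ i, (σ i x * N i x) ^ (1 / E)
            = (u x * ∏ i, σ i x ^ ((1 - e i) * (1 / E)))
              * ∏ i, (N i x ^ (1 / e i) * σ i x) ^ (e i / E) := by
              rw [mul_assoc, ← Finset.prod_mul_distrib]
              congr 1
              refine Finset.prod_congr rfl fun i _ => ?_
              rw [ENNReal.mul_rpow_of_nonneg _ _ (by positivity), h3 i,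
                ENNReal.mul_rpow_of_nonneg _ _ (heE i), ← ENNReal.rpow_mul,
                show 1 / e i * (e i / E) = 1 / E by have := (he i).ne'; field_simp]
              ring
          _ = _ := by rw [h2, one_mul]
    _ ≤ K' ^ (1 / θ) * (D * ∏ i, (∫⁻ x, N i x ^ (1 / e i) * σ i x) ^ (e i / E)) := by
        gcongr
        refine ENNReal.lintegral_prod_norm_pow_le _
          (fun i _ => (((hN i).pow_const _).mul (hσ i)).aemeasurable) ?_ fun i _ => heE i
        rw [← Finset.sum_div, div_self hE.ne']
    _ ≤ K' ^ (1 / θ) * (D * ∏ i, (D' i * ∫⁻ x, h i x ^ (1 / e i) * σ i x) ^ (e i / E)) := by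
        gcongr with i
        · exact heE i
        have := hDM' i (volume.withDensity (σ i)) (h i) (hh i)
        rw [lintegral_withDensity_eq_lintegral_mul _ (hσ i) ((hN i).pow_const _),
          lintegral_withDensity_eq_lintegral_mul _ (hσ i) ((hh i).pow_const _)] at this
        simpa only [Pi.mul_apply, mul_comm (σ i _)] using this
    _ = _ := by
        simp_rw [fun i => ENNReal.mul_rpow_of_nonneg (D' i)
          (∫⁻ x, h i x ^ (1 / e i) * σ i x) (heE i)]
        rw [Finset.prod_mul_distrib]
        ring

end MultilinearMaximal

/-! ### From cubes to dyadic balls, and from order `α` to order zero. -/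

section FractionalMaximal

open Metric Set

variable {n : ℕ}

theorem volume_cube (a : Fin n → ℝ) (r : ℝ) : volume (cube a r) = ENNReal.ofReal r ^ n := by
  simp [cube, Real.volume_Icc_pi]

theorem closedBall_eq_cube (x : Fin n → ℝ) {r : ℝ} (hr : 0 < r) :
    closedBall x r = cube (fun j => x j - r) (2 * r) := by
  ext y
  simp only [mem_closedBall, dist_pi_le_iff hr.le, Real.dist_eq, abs_le, cube, mem_Icc, Pi.le_def,
    ← forall_and]
  refine forall_congr' fun j => ?_
  constructor <;> rintro ⟨h1, h2⟩ <;> constructor <;> linarith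

theorem cube_subset_closedBall {a x : Fin n → ℝ} {r s : ℝ} (hx : x ∈ cube a r) (hs : 0 ≤ s)
    (hrs : r ≤ s) : cube a r ⊆ closedBall x s := by
  intro y hy
  rw [mem_closedBall, dist_pi_le_iff hs]
  intro j
  have h1 := hx.1 j
  have h2 := hx.2 j
  have h3 := hy.1 j
  have h4 := hy.2 j
  rw [Real.dist_eq, abs_le]
  constructor <;> linarith

/-- If `2^k ≤ r < 2^(k+1)`, the ball of radius `2^(k+1)` about `x` contains the cube and has side at
most `4 r`. The radius is independent of `φ`, so one ball serves all factors of a product. -/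
theorem exists_setLAverage_cube_le {a x : Fin n → ℝ} {r : ℝ} (hr : 0 < r) (hx : x ∈ cube a r) :
    ∃ k : ℤ, ∀ φ : (Fin n → ℝ) → ℝ≥0∞, ⨍⁻ y in cube a r, φ y ∂volume
      ≤ 4 ^ n * ⨍⁻ y in closedBall x ((2 : ℝ) ^ k), φ y ∂volume := by
  obtain ⟨k, hk, hk'⟩ := exists_mem_Ico_zpow hr one_lt_two
  refine ⟨k + 1, fun φ => ?_⟩
  have hR : (2 : ℝ) ^ (k + 1) ≤ 2 * r := by
    rw [zpow_add_one₀ two_ne_zero]; linarith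
  have hvol : volume (closedBall x ((2 : ℝ) ^ (k + 1))) ≤ 4 ^ n * volume (cube a r) := by
    rw [Real.volume_pi_closedBall _ (by positivity), volume_cube, ← mul_pow, Fintype.card_fin,
      ENNReal.ofReal_pow (by positivity)]
    gcongr
    rw [← ENNReal.ofReal_ofNat, ← ENNReal.ofReal_mul (by norm_num)]
    exact ENNReal.ofReal_le_ofReal (by linarith)
  have h0 : volume (closedBall x ((2 : ℝ) ^ (k + 1))) ≠ 0 :=
    (measure_closedBall_pos volume x (by positivity)).ne'
  have hfin : volume (closedBall x ((2 : ℝ) ^ (k + 1))) ≠ ∞ := measure_closedBall_lt_top.ne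
  have hc0 : volume (cube a r) ≠ 0 := by simp [volume_cube, hr]
  have hc : volume (cube a r) ≠ ∞ := by rw [volume_cube]; finiteness
  rw [setLAverage_eq, setLAverage_eq]
  refine ENNReal.div_le_of_le_mul ?_
  calc ∫⁻ y in cube a r, φ y
      ≤ ∫⁻ y in closedBall x ((2 : ℝ) ^ (k + 1)), φ y :=
        lintegral_mono_set (cube_subset_closedBall hx (by positivity) hk'.le)
    _ = (∫⁻ y in closedBall x ((2 : ℝ) ^ (k + 1)), φ y) / volume (closedBall x ((2 : ℝ) ^ (k + 1)))
        * volume (closedBall x ((2 : ℝ) ^ (k + 1))) := (ENNReal.div_mul_cancel h0 hfin).symm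
    _ ≤ _ := by
        refine (mul_le_mul_right hvol _).trans_eq ?_
        ring

/-- Hölder for `g = g^(pβ) g^(r(1-β))` with `g = f / σ`, against the measure `σ dμ`. -/
theorem lintegral_le_rpow_mul_rpow {α : Type*} [MeasurableSpace α] (μ : Measure α)
    {f σ : α → ℝ≥0∞} (hf : Measurable f) (hσ : Measurable σ) (hσ0 : ∀ᵐ x ∂μ, σ x ≠ 0)
    (hσfin : ∀ᵐ x ∂μ, σ x ≠ ∞) {p r β : ℝ} (hp : 0 ≤ p) (hr : 0 ≤ r) (hβ : 0 ≤ β) (hβ1 : β ≤ 1)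
    (hpr : p * β + r * (1 - β) = 1) :
    ∫⁻ x, f x ∂μ ≤ (∫⁻ x, (f x / σ x) ^ p * σ x ∂μ) ^ β
      * (∫⁻ x, (f x / σ x) ^ r * σ x ∂μ) ^ (1 - β) := by
  have hβ' : 0 ≤ 1 - β := sub_nonneg.2 hβ1
  calc ∫⁻ x, f x ∂μ
      = ∫⁻ x, ((f x / σ x) ^ p * σ x) ^ β * ((f x / σ x) ^ r * σ x) ^ (1 - β) ∂μ := by
        refine lintegral_congr_ae ?_
        filter_upwards [hσ0, hσfin] with x h0 hfin
        rw [ENNReal.mul_rpow_of_nonneg _ _ hβ, ENNReal.mul_rpow_of_nonneg _ _ hβ', mul_mul_mul_comm,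
          ← ENNReal.rpow_mul, ← ENNReal.rpow_mul,
          ← ENNReal.rpow_add_of_nonneg _ _ (by positivity) (by positivity),
          ← ENNReal.rpow_add_of_nonneg _ _ hβ hβ', hpr, add_sub_cancel, ENNReal.rpow_one,
          ENNReal.rpow_one, ENNReal.div_mul_cancel h0 hfin]
    _ ≤ _ := ENNReal.lintegral_mul_norm_pow_le
        (((hf.div hσ).pow_const _).mul hσ).aemeasurable
        (((hf.div hσ).pow_const _).mul hσ).aemeasurable hβ hβ' (add_sub_cancel _ _)

theorem measurable_multiMaximal {ι : Type*} [Fintype ι] {σ h : ι → (Fin n → ℝ) → ℝ≥0∞}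
    (hσ : ∀ i, Measurable (σ i)) (hh : ∀ i, Measurable (h i)) :
    Measurable (multiMaximal σ h) := by
  refine Measurable.iSup fun k => Finset.measurable_fun_prod _ fun i _ => ?_
  simp_rw [setLAverage_eq]
  refine (measurable_setLIntegral_closedBall volume ((hh i).mul (hσ i)) _).div ?_
  simpa using measurable_setLIntegral_closedBall volume
    (measurable_const (a := (1 : ℝ≥0∞))) ((2 : ℝ) ^ k)

/-- Hölder's inequality bounds the fractional averages by averages of order zero. -/
theorem rpow_mul_prod_setLAverage_le {ι : Type*} [Fintype ι]
    {f σ : ι → (Fin n → ℝ) → ℝ≥0∞} (hf : ∀ i, Measurable (f i)) (hσ : ∀ i, Measurable (σ i))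
    (hσ0 : ∀ i, ∀ᵐ x, σ i x ≠ 0) (hσfin : ∀ i, ∀ᵐ x, σ i x ≠ ∞) {p r : ι → ℝ} {β : ℝ}
    (hp : ∀ i, 0 ≤ p i) (hr : ∀ i, 0 ≤ r i) (hβ : 0 ≤ β) (hβ1 : β ≤ 1)
    (hpr : ∀ i, p i * β + r i * (1 - β) = 1) {a x : Fin n → ℝ} {l : ℝ} (hl : 0 < l)
    (hx : x ∈ cube a l) :
    volume (cube a l) ^ (Fintype.card ι * β) * ∏ i, ⨍⁻ y in cube a l, f i y ∂volume
      ≤ (∏ i, (∫⁻ y, (f i y / σ i y) ^ p i * σ i y) ^ β)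
        * ((4 ^ n) ^ Fintype.card ι * multiMaximal σ (fun i y => (f i y / σ i y) ^ r i) x)
          ^ (1 - β) := by
  have hβ' : 0 ≤ 1 - β := sub_nonneg.2 hβ1
  obtain ⟨k, hk⟩ := exists_setLAverage_cube_le hl hx
  set V := volume (cube a l) with hVdef
  have hV0 : V ≠ 0 := by simp [hVdef, volume_cube, hl]
  have hV : V ≠ ∞ := by rw [hVdef, volume_cube]; finiteness
  have hone : ∀ i, V ^ β * ⨍⁻ y in cube a l, f i y ∂volume
      ≤ (∫⁻ y, (f i y / σ i y) ^ p i * σ i y) ^ β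
        * (⨍⁻ y in cube a l, (f i y / σ i y) ^ r i * σ i y ∂volume) ^ (1 - β) := by
    intro i
    have h := lintegral_le_rpow_mul_rpow (volume.restrict (cube a l)) (hf i) (hσ i)
      (ae_restrict_of_ae (hσ0 i)) (ae_restrict_of_ae (hσfin i)) (hp i) (hr i) hβ hβ1 (hpr i)
    -- The fractional factor leaves exactly the normalisation of the mean raised to `1 - β`.
    have hVV : V ^ β * V⁻¹ = (V⁻¹) ^ (1 - β) := by
      rw [ENNReal.inv_rpow, ← ENNReal.rpow_neg, ← ENNReal.rpow_neg_one, ← ENNReal.rpow_add _ _ hV0 hV]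
      congr 1
      ring
    rw [setLAverage_eq, setLAverage_eq, ← hVdef, div_eq_mul_inv, div_eq_mul_inv,
      ENNReal.mul_rpow_of_nonneg _ _ hβ', ← hVV, mul_left_comm,
      ← mul_assoc (_ ^ β) (_ ^ (1 - β))]
    refine mul_le_mul_left (h.trans ?_) _
    gcongr
    exact Measure.restrict_le_self
  have hcard : V ^ (Fintype.card ι * β) = ∏ _i : ι, V ^ β := by
    rw [Finset.prod_const, Finset.card_univ, ← ENNReal.rpow_natCast, ← ENNReal.rpow_mul, mul_comm]
  rw [hcard, ← Finset.prod_mul_distrib]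
  calc ∏ i, V ^ β * ⨍⁻ y in cube a l, f i y ∂volume
      ≤ ∏ i, (∫⁻ y, (f i y / σ i y) ^ p i * σ i y) ^ β
        * (⨍⁻ y in cube a l, (f i y / σ i y) ^ r i * σ i y ∂volume) ^ (1 - β) :=
        Finset.prod_le_prod' fun i _ => hone i
    _ = (∏ i, (∫⁻ y, (f i y / σ i y) ^ p i * σ i y) ^ β)
        * (∏ i, ⨍⁻ y in cube a l, (f i y / σ i y) ^ r i * σ i y ∂volume) ^ (1 - β) := by
        rw [Finset.prod_mul_distrib, ENNReal.prod_rpow_of_nonneg hβ']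
    _ ≤ _ := by
        gcongr
        calc ∏ i, ⨍⁻ y in cube a l, (f i y / σ i y) ^ r i * σ i y ∂volume
            ≤ ∏ i, 4 ^ n * ⨍⁻ y in closedBall x ((2 : ℝ) ^ k),
                (f i y / σ i y) ^ r i * σ i y ∂volume :=
              Finset.prod_le_prod' fun i _ => hk _
          _ = (4 ^ n) ^ Fintype.card ι * ∏ i, ⨍⁻ y in closedBall x ((2 : ℝ) ^ k),
                (f i y / σ i y) ^ r i * σ i y ∂volume := by
              rw [Finset.prod_mul_distrib, Finset.prod_const, Finset.card_univ]
          _ ≤ _ := by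
              gcongr
              exact le_iSup (fun k : ℤ => ∏ i, ⨍⁻ y in closedBall x ((2 : ℝ) ^ k),
                (f i y / σ i y) ^ r i * σ i y ∂volume) k

/-- Under the multilinear Muckenhoupt condition either `u` vanishes or all weights are locally
integrable. -/
theorem ae_eq_zero_or_locally_finite {ι : Type*} [Fintype ι] {u : (Fin n → ℝ) → ℝ≥0∞}
    {σ : ι → (Fin n → ℝ) → ℝ≥0∞} (hu : Measurable u) (hσ : ∀ i, Measurable (σ i))
    (hσ0 : ∀ i x, σ i x ≠ 0) {E : ℝ} {d : ι → ℝ} (hE : 0 < E) (hd : ∀ i, 0 < d i)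
    {K : ℝ≥0∞} (hKfin : K ≠ ∞) (hK : ∀ x : Fin n → ℝ, ∀ r : ℝ, 0 < r →
      (⨍⁻ y in closedBall x r, u y ∂volume) ^ E
        * ∏ i, (⨍⁻ y in closedBall x r, σ i y ∂volume) ^ d i ≤ K) :
    (∀ᵐ x, u x = 0) ∨
      ((∀ x : Fin n → ℝ, ∀ r : ℝ, ∫⁻ y in closedBall x r, u y ≠ ∞) ∧
        ∀ i, ∀ x : Fin n → ℝ, ∀ r : ℝ, ∫⁻ y in closedBall x r, σ i y ≠ ∞) := by
  by_cases hu0 : ∀ᵐ x, u x = 0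
  · exact Or.inl hu0
  right
  have hR : ∃ R : ℕ, ∫⁻ y in closedBall (0 : Fin n → ℝ) R, u y ≠ 0 := by
    by_contra! hcon
    refine hu0 ?_
    have h : ∀ R : ℕ, ∀ᵐ x ∂volume, x ∈ closedBall (0 : Fin n → ℝ) R → u x = 0 := fun R =>
      (ae_restrict_iff' measurableSet_closedBall).1 ((lintegral_eq_zero_iff hu).1 (hcon R))
    filter_upwards [ae_all_iff.2 h] with x hx
    obtain ⟨R, hR⟩ := exists_nat_ge (dist x 0)
    exact hx R hR
  obtain ⟨R₀, hR₀⟩ := hR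
  -- On a ball where `u` has mass every factor is positive, since the `σ i` never vanish. An
  -- infinite factor would then make the product infinite.
  have key : ∀ R : ℝ, 0 < R → (R₀ : ℝ) ≤ R → ∫⁻ y in closedBall (0 : Fin n → ℝ) R, u y ≠ ∞ ∧
      ∀ i, ∫⁻ y in closedBall (0 : Fin n → ℝ) R, σ i y ≠ ∞ := by
    intro R hR hRR
    have hB0 : volume (closedBall (0 : Fin n → ℝ) R) ≠ 0 := (measure_closedBall_pos volume _ hR).ne'
    have hB : volume (closedBall (0 : Fin n → ℝ) R) ≠ ∞ := measure_closedBall_lt_top.ne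
    have h := ((hK 0 R hR).trans_lt (lt_top_iff_ne_top.2 hKfin)).ne
    have hup : 0 < ∫⁻ y in closedBall (0 : Fin n → ℝ) R, u y :=
      (pos_iff_ne_zero.2 hR₀).trans_le (lintegral_mono_set (closedBall_subset_closedBall hRR))
    have hσp : ∀ i, 0 < ∫⁻ y in closedBall (0 : Fin n → ℝ) R, σ i y := fun i => by
      rw [setLIntegral_pos_iff (hσ i)]
      rwa [show Function.support (σ i) = univ from eq_univ_of_forall (hσ0 i), univ_inter,
        pos_iff_ne_zero]
    have hpos : ∀ {b : ℝ≥0∞} {s : ℝ}, 0 < b → 0 < s →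
        (b / volume (closedBall (0 : Fin n → ℝ) R)) ^ s ≠ 0 := fun hb hs => by
      rw [Ne, ENNReal.rpow_eq_zero_iff_of_pos hs]
      exact (ENNReal.div_pos hb.ne' hB).ne'
    have htop : ∀ {b : ℝ≥0∞} {s : ℝ}, 0 < s →
        (b / volume (closedBall (0 : Fin n → ℝ) R)) ^ s ≠ ∞ → b ≠ ∞ := by
      rintro b s hs hne rfl
      exact hne (by rw [ENNReal.top_div_of_ne_top hB, ENNReal.top_rpow_of_pos hs])
    simp_rw [setLAverage_eq] at h
    have hP0 : ∏ i, ((∫⁻ y in closedBall (0 : Fin n → ℝ) R, σ i y)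
        / volume (closedBall (0 : Fin n → ℝ) R)) ^ d i ≠ 0 :=
      Finset.prod_ne_zero_iff.2 fun i _ => hpos (hσp i) (hd i)
    refine ⟨htop hE fun hcon => h (by rw [hcon, ENNReal.top_mul hP0]), fun i =>
      htop (hd i) fun hcon => h ?_⟩
    rw [(ENNReal.mul_eq_top).2 (Or.inl ⟨hpos hup hE, ?_⟩)]
    classical
    rw [← Finset.mul_prod_erase _ _ (Finset.mem_univ i), hcon, ENNReal.top_mul]
    exact Finset.prod_ne_zero_iff.2 fun j _ => hpos (hσp j) (hd j)
  have hsub : ∀ (x : Fin n → ℝ) (r : ℝ), ∃ R : ℝ, 0 < R ∧ (R₀ : ℝ) ≤ R ∧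
      closedBall x r ⊆ closedBall 0 R := by
    intro x r
    refine ⟨|r| + dist x 0 + R₀ + 1, by positivity, ?_, closedBall_subset_closedBall' ?_⟩
    · have := dist_nonneg (x := x) (y := 0)
      linarith [abs_nonneg r]
    · linarith [le_abs_self r, (Nat.cast_nonneg R₀ : (0 : ℝ) ≤ R₀)]
  refine ⟨fun x r => ?_, fun i x r => ?_⟩ <;> obtain ⟨R, hR0, hR, hs⟩ := hsub x r
  · exact ne_top_of_le_ne_top (key R hR0 hR).1 (lintegral_mono_set hs)
  · exact ne_top_of_le_ne_top ((key R hR0 hR).2 i) (lintegral_mono_set hs)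

end FractionalMaximal

/-! ### The fractional bound in terms of the densities, and the exponents. -/

section WeightedBound

open Metric Set

variable {n : ℕ}

/-- The weighted bound for the multilinear fractional maximal function of nonnegative functions, in
terms of the densities `u` and `σ`. -/
theorem exists_lintegral_iSup_cube_le {ι : Type*} [Fintype ι] [Nonempty ι]
    {u : (Fin n → ℝ) → ℝ≥0∞} {σ : ι → (Fin n → ℝ) → ℝ≥0∞} (hu : Measurable u)
    (hσ : ∀ i, Measurable (σ i)) {e : ι → ℝ} (he : ∀ i, 0 < e i) (he1 : ∀ i, e i < 1)
    (h1 : ∀ᵐ x, u x ^ (∑ i, e i) * ∏ i, σ i x ^ (1 - e i) = 1)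
    (hu0 : ∀ᵐ x, u x ≠ 0) (hσ0 : ∀ i, ∀ᵐ x, σ i x ≠ 0) (hσtop : ∀ i, ∀ᵐ x, σ i x ≠ ∞)
    (hufin : ∀ x : Fin n → ℝ, ∀ r : ℝ, ∫⁻ y in closedBall x r, u y ≠ ∞)
    (hσfin : ∀ i, ∀ x : Fin n → ℝ, ∀ r : ℝ, ∫⁻ y in closedBall x r, σ i y ≠ ∞)
    {K : ℝ≥0∞} (hKfin : K ≠ ∞) (hK : ∀ x : Fin n → ℝ, ∀ r : ℝ, 0 < r →
      (⨍⁻ y in closedBall x r, u y ∂volume) ^ (∑ i, e i)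
        * ∏ i, (⨍⁻ y in closedBall x r, σ i y ∂volume) ^ (1 - e i) ≤ K)
    {p : ι → ℝ} {β q : ℝ} (hp : ∀ i, 0 < p i) (hβ : 0 ≤ β) (hβ1 : β < 1)
    (hpe : ∀ i, e i * (1 - β) = 1 / p i - β) (hq : q = 1 / ((1 - β) * ∑ i, e i)) :
    ∃ C : ℝ≥0∞, C ≠ ∞ ∧ ∀ f : ι → (Fin n → ℝ) → ℝ≥0∞, (∀ i, Measurable (f i)) →
      ∫⁻ x, (⨆ (a : Fin n → ℝ) (r : ℝ) (_ : 0 < r) (_ : x ∈ cube a r),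
          volume (cube a r) ^ (Fintype.card ι * β)
            * ∏ i, ⨍⁻ y in cube a r, f i y ∂volume) ^ q * u x
        ≤ C * ∏ i, (∫⁻ x, (f i x / σ i x) ^ p i * σ i x) ^ (q / p i) := by
  have hE : 0 < ∑ i, e i := Finset.sum_pos (fun i _ => he i) Finset.univ_nonempty
  have hβ' : 0 < 1 - β := sub_pos.2 hβ1
  have hq0 : 0 < q := by rw [hq]; positivity
  obtain ⟨C, hC, hCM⟩ := exists_lintegral_multiMaximal_le hu hσ he he1 h1 hu0 hσ0 hufin hσfin
    hKfin hK
  set E := ∑ i, e i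
  set D : ℝ≥0∞ := ((4 ^ n) ^ Fintype.card ι) ^ (1 / E)
  refine ⟨D * C, ENNReal.mul_ne_top (ENNReal.rpow_ne_top_of_nonneg (by positivity)
    (by finiteness)) hC, fun f hf => ?_⟩
  -- With this power, `h i ^ (1 / e i)` is again `(f i / σ i) ^ p i`, so both Hölder factors involve
  -- the same integral `L i`.
  set h : ι → (Fin n → ℝ) → ℝ≥0∞ := fun i y => (f i y / σ i y) ^ (p i * e i)
  have hh : ∀ i, Measurable (h i) := fun i => ((hf i).div (hσ i)).pow_const _
  set L : ι → ℝ≥0∞ := fun i => ∫⁻ x, (f i x / σ i x) ^ p i * σ i x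
  have hqE : (1 - β) * q = 1 / E := by rw [hq]; field_simp
  have hpr : ∀ i, p i * β + p i * e i * (1 - β) = 1 := fun i => by
    have := (hp i).ne'
    rw [mul_assoc, hpe i]
    field_simp
    ring
  have hpt : ∀ x, (⨆ (a : Fin n → ℝ) (r : ℝ) (_ : 0 < r) (_ : x ∈ cube a r),
      volume (cube a r) ^ (Fintype.card ι * β) * ∏ i, ⨍⁻ y in cube a r, f i y ∂volume) ^ q
      ≤ (∏ i, L i ^ (β * q)) * D * multiMaximal σ h x ^ (1 / E) := by
    intro x
    calc _ ≤ ((∏ i, L i ^ β)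
            * ((4 ^ n) ^ Fintype.card ι * multiMaximal σ h x) ^ (1 - β)) ^ q := by
          gcongr
          refine iSup_le fun a => iSup_le fun r => iSup_le fun hr => iSup_le fun hx => ?_
          exact rpow_mul_prod_setLAverage_le hf hσ hσ0 hσtop (fun i => (hp i).le)
            (fun i => (mul_pos (hp i) (he i)).le) hβ hβ1.le hpr hr hx
      _ = _ := by
          rw [ENNReal.mul_rpow_of_nonneg _ _ hq0.le, ← ENNReal.rpow_mul, hqE,
            ENNReal.mul_rpow_of_nonneg _ _ (by positivity), ← ENNReal.prod_rpow_of_nonneg hq0.le,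
            Finset.prod_congr rfl fun i _ => (ENNReal.rpow_mul (L i) β q).symm, mul_assoc]
  have hmeas : Measurable fun x => multiMaximal σ h x ^ (1 / E) * u x :=
    ((measurable_multiMaximal hσ hh).pow_const _).mul hu
  have hh' : ∀ i x, h i x ^ (1 / e i) = (f i x / σ i x) ^ p i := fun i x => by
    have := (he i).ne'
    rw [← ENNReal.rpow_mul]
    congr 1
    field_simp
  calc _ ≤ ∫⁻ x, ((∏ i, L i ^ (β * q)) * D) * (multiMaximal σ h x ^ (1 / E) * u x) := by
        refine lintegral_mono fun x => ?_
        rw [← mul_assoc]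
        exact mul_le_mul_left (hpt x) _
    _ ≤ ((∏ i, L i ^ (β * q)) * D) * (C * ∏ i, L i ^ (e i / E)) := by
        rw [lintegral_const_mul _ hmeas]
        gcongr
        refine (hCM h hh).trans_eq ?_
        simp_rw [hh']
        rfl
    _ = D * C * ∏ i, L i ^ (β * q) * L i ^ (e i / E) := by
        rw [Finset.prod_mul_distrib]
        ring
    _ = _ := by
        congr 1
        refine Finset.prod_congr rfl fun i _ => ?_
        rw [← ENNReal.rpow_add_of_nonneg _ _ (by positivity) (div_nonneg (he i).le hE.le)]
        congr 1
        calc β * q + e i / E = β * q + e i * ((1 - β) * q) := by rw [hqE]; ring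
          _ = q * (β + e i * (1 - β)) := by ring
          _ = q / p i := by rw [hpe i]; ring

/-- The relations between the exponents, with `β = α / (n m)`. -/
theorem exponent_relations {p s r q β E : ℝ} (hp : 1 < p) (hβ1 : β < 1) (hβp : β < 1 / p)
    (hr : 1 / r = 1 / p - β) (hs : s = (1 - β) * r) (hE : 0 < E) (hq : q = 1 / ((1 - β) * E)) :
    0 < r ∧ 1 < s ∧ 1 / s * (1 - β) = 1 / p - β ∧ r * (1 / E / s) = q ∧
      r * (1 - s.conjExponent) = -(p / (p - 1)) ∧ 1 / s.conjExponent = 1 - 1 / s ∧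
      q * E = p / (p - 1) * (1 - 1 / s) := by
  have hp0 : 0 < p := one_pos.trans hp
  have hp1 : 0 < p - 1 := sub_pos.2 hp
  have hβ' : 0 < 1 - β := sub_pos.2 hβ1
  have hr0 : 0 < r := one_div_pos.1 (hr ▸ sub_pos.2 hβp)
  have hd : 0 < 1 - p * β := by
    have := mul_lt_mul_of_pos_left hβp hp0
    rw [mul_one_div_cancel hp0.ne'] at this
    linarith
  have hr' : r = p / (1 - p * β) := by
    rw [← one_div_one_div r, hr]
    field_simp
  have hs1 : s - 1 = (p - 1) / (1 - p * β) := by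
    rw [hs, hr', eq_div_iff hd.ne', sub_mul, mul_assoc, div_mul_cancel₀ _ hd.ne']
    ring
  have hs0 : 1 < s := by
    have : 0 < s - 1 := by rw [hs1]; positivity
    linarith
  have hspos : 0 < s := one_pos.trans hs0
  have hs1' : s - 1 ≠ 0 := (sub_pos.2 hs0).ne'
  have h3 : 1 / s * (1 - β) = 1 / p - β := by rw [hs, ← hr]; field_simp
  refine ⟨hr0, hs0, h3, ?_, ?_, ?_, ?_⟩
  · rw [hs, hq]
    field_simp
  · have : 1 - s.conjExponent = -1 / (s - 1) := by
      rw [Real.conjExponent]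
      field_simp
      ring
    rw [this, hs1, hr']
    field_simp
  · rw [Real.conjExponent]
    field_simp
  -- In conjugate exponents this is `(1 - β) / s' = 1 / p'`, and `q E = 1 / (1 - β)`.
  · have h4 : (1 - 1 / s) * (1 - β) = (p - 1) / p := by
      rw [sub_mul, h3]
      field_simp
      ring
    have h5 : 1 - 1 / s = (p - 1) / p / (1 - β) := by rw [← h4]; field_simp
    rw [h5, hq]
    field_simp

/-- With `p' = p/(p-1)`, the exponent of `w` is `p p' - p' = p`. This identifies the integrals
against `σ` with the weighted norms. -/
theorem div_rpow_neg_rpow_mul (b : ℝ≥0∞) {w : ℝ≥0} (hw : w ≠ 0) {p : ℝ} (hp : 1 < p) :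
    (b / (w : ℝ≥0∞) ^ (-(p / (p - 1)))) ^ p * (w : ℝ≥0∞) ^ (-(p / (p - 1)))
      = (w * b) ^ p := by
  have hp0 : 0 ≤ p := by linarith
  have hp1 : p - 1 ≠ 0 := (sub_pos.2 hp).ne'
  rw [div_eq_mul_inv, ← ENNReal.rpow_neg, neg_neg, ENNReal.mul_rpow_of_nonneg _ _ hp0,
    ← ENNReal.rpow_mul, mul_assoc,
    ← ENNReal.rpow_add _ _ (ENNReal.coe_ne_zero.2 hw) ENNReal.coe_ne_top,
    ENNReal.mul_rpow_of_nonneg _ _ hp0, mul_comm]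
  congr 2
  field_simp
  ring

end WeightedBound

end MultiFrac

/-! ### The theorem for the given weights. -/

theorem mainTheorem10 {𝕜 : Type*} [RCLike 𝕜] {n m : ℕ} (α : ℝ)
    (hα : 0 < α) (hαnm : α < n * m)
    (p qs ss : Fin m → ℝ) (q : ℝ)
    (hp : ∀ i, 1 < p i ∧ p i < n * m / α)
    (hqs : ∀ i, 1 / qs i = 1 / p i - α / (n * m))
    (hss : ∀ i, ss i = (1 - α / (n * m)) * qs i)
    (hq : 1 / q = ∑ i, 1 / qs i)
    (w : Fin m → (Fin n → ℝ) → ℝ≥0)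
    (hwm : ∀ i, AEMeasurable (w i) volume)
    (hw : MultiFrac.MultiAP ss (fun i x => w i x ^ qs i)) :
    ∃ C : ℝ≥0, ∀ f : Fin m → (Fin n → ℝ) → 𝕜,
      (∀ i, AEStronglyMeasurable (f i) volume) →
      eLpNorm (fun x => MultiFrac.fracMaximal α f x * ∏ i, (w i x : ℝ≥0∞))
          (ENNReal.ofReal q) volume
        ≤ C * ∏ i, eLpNorm (fun x => (w i x : ℝ) • f i x) (ENNReal.ofReal (p i)) volume := by
  have hnm : (0 : ℝ) < n * m := hα.trans hαnm
  have hn : (n : ℝ) ≠ 0 := fun h => by simp [h] at hnm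
  have hm : (m : ℝ) ≠ 0 := fun h => by simp [h] at hnm
  have : Nonempty (Fin m) := Fin.pos_iff_nonempty.1 (Nat.pos_of_ne_zero (by exact_mod_cast hm))
  set β := α / (n * m) with hβdef
  have hβ0 : 0 < β := by positivity
  have hβ1 : β < 1 := (div_lt_one hnm).2 hαnm
  have hβ' : 0 < 1 - β := sub_pos.2 hβ1
  have hβp : ∀ i, β < 1 / p i := fun i => by
    rw [hβdef, ← one_div_div, one_div_lt_one_div (by positivity) (one_pos.trans (hp i).1)]
    exact (hp i).2
  have hqs0 : ∀ i, 0 < 1 / qs i := fun i => (hqs i).symm ▸ sub_pos.2 (hβp i)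
  set E := ∑ i, 1 / ss i with hEdef
  have hqE : (1 - β) * E = 1 / q := by
    rw [hq, hEdef, Finset.mul_sum]
    refine Finset.sum_congr rfl fun i _ => ?_
    rw [hss i]
    field_simp
  have hE : 0 < E := by
    have : 0 < 1 / q := hq ▸ Finset.sum_pos (fun i _ => hqs0 i) Finset.univ_nonempty
    rw [← hqE] at this
    exact pos_of_mul_pos_right this hβ'.le
  have hq' : q = 1 / ((1 - β) * E) := by rw [hqE, one_div_one_div]
  have hq0 : 0 < q := by rw [hq']; positivity
  have hrel := fun i => MultiFrac.exponent_relations (hp i).1 hβ1 (hβp i) (hqs i) (hss i) hE hq'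
  have hp0 : ∀ i, 0 < p i := fun i => one_pos.trans (hp i).1
  have hp1 : ∀ i, 0 < p i / (p i - 1) := fun i => div_pos (hp0 i) (sub_pos.2 (hp i).1)
  have hs1 : ∀ i, 1 / ss i < 1 := fun i => (div_lt_one (one_pos.trans (hrel i).2.1)).2 (hrel i).2.1
  have hs0 : ∀ i, 0 < 1 / ss i := fun i => one_div_pos.2 (one_pos.trans (hrel i).2.1)
  set v : Fin m → (Fin n → ℝ) → ℝ≥0 := fun i => (hwm i).mk (w i)
  have hv : ∀ i, Measurable (v i) := fun i => (hwm i).measurable_mk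
  have hwv : ∀ᵐ x, ∀ i, w i x = v i x := ae_all_iff.2 fun i => (hwm i).ae_eq_mk
  -- These are the densities of the condition: `q_i s / s_i = q` and `q_i (1 - s_i') = -p_i'`.
  -- Measurable representatives `v i` replace the weights.
  set u : (Fin n → ℝ) → ℝ≥0∞ := fun x => (∏ i, (v i x : ℝ≥0∞)) ^ q
  set σ : Fin m → (Fin n → ℝ) → ℝ≥0∞ := fun i x => (v i x : ℝ≥0∞) ^ (-(p i / (p i - 1)))
  have hu : Measurable u :=
    (Finset.measurable_fun_prod _ fun i _ => (hv i).coe_nnreal_ennreal).pow_const _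
  have hσ : ∀ i, Measurable (σ i) := fun i => (hv i).coe_nnreal_ennreal.pow_const _
  have hσ0 : ∀ i x, σ i x ≠ 0 := fun i x => by
    simp only [σ, ENNReal.rpow_neg, Ne, ENNReal.inv_eq_zero]
    exact ENNReal.rpow_ne_top_of_nonneg (hp1 i).le ENNReal.coe_ne_top
  obtain ⟨K, hKfin, hK⟩ : ∃ K : ℝ≥0∞, K ≠ ∞ ∧ ∀ x : Fin n → ℝ, ∀ r : ℝ, 0 < r →
      (⨍⁻ y in Metric.closedBall x r, u y ∂volume) ^ E
        * ∏ i, (⨍⁻ y in Metric.closedBall x r, σ i y ∂volume) ^ (1 - 1 / ss i) ≤ K := by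
    refine ⟨_, ne_of_lt hw, fun x r hr => ?_⟩
    refine le_trans (le_of_eq ?_) (le_iSup_of_le (fun j => x j - r) (le_iSup_of_le (2 * r)
      (le_iSup_of_le (by positivity) le_rfl)))
    rw [MultiFrac.closedBall_eq_cube x hr]
    have hharm : MultiFrac.harmonicExponent ss = 1 / E := rfl
    rw [hharm, one_div_one_div]
    congr 2
    · refine laverage_congr (ae_restrict_of_ae ?_)
      filter_upwards [hwv] with y hy
      simp only [u]
      rw [← ENNReal.prod_rpow_of_nonneg hq0.le]
      refine Finset.prod_congr rfl fun i _ => ?_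
      rw [hy i, ENNReal.coe_rpow_of_nonneg _ (hrel i).1.le, ← ENNReal.rpow_mul, (hrel i).2.2.2.1]
    · funext i
      rw [MultiFrac.dualFactor, if_neg (hrel i).2.1.ne', (hrel i).2.2.2.2.2.1]
      congr 1
      refine laverage_congr (ae_restrict_of_ae ?_)
      filter_upwards [hwv] with y hy
      simp only [σ]
      rw [hy i, ENNReal.coe_rpow_of_nonneg _ (hrel i).1.le, ← ENNReal.rpow_mul,
        (hrel i).2.2.2.2.1]
  rcases MultiFrac.ae_eq_zero_or_locally_finite hu hσ hσ0 hE (fun i => sub_pos.2 (hs1 i)) hKfin hK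
    with hu0 | ⟨hufin, hσfin⟩
  -- Here `∏ w i = 0` almost everywhere, and `∞ * 0 = 0` makes the left side vanish even where the
  -- maximal function is infinite.
  · refine ⟨0, fun f _ => ?_⟩
    rw [eLpNorm_congr_ae (g := fun _ => 0), eLpNorm_zero']
    · exact zero_le
    filter_upwards [hu0, hwv] with x hx hwx
    rw [Finset.prod_congr rfl fun i _ => by rw [hwx i],
      (ENNReal.rpow_eq_zero_iff_of_pos hq0).1 hx, mul_zero]
  have hσtop : ∀ i, ∀ᵐ x, σ i x ≠ ∞ := fun i => by
    have h : ∀ R : ℕ, ∀ᵐ x ∂volume, x ∈ Metric.closedBall (0 : Fin n → ℝ) R → σ i x < ∞ := fun R =>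
      (ae_restrict_iff' measurableSet_closedBall).1 (ae_lt_top (hσ i) (hσfin i 0 R))
    filter_upwards [ae_all_iff.2 h] with x hx
    obtain ⟨R, hR⟩ := exists_nat_ge (dist x 0)
    exact (hx R hR).ne
  -- A negative power of `0` is `∞`, so finiteness of the `σ i` rules out zeros of the weights up to
  -- a null set.
  have hv0 : ∀ᵐ x, ∀ i, v i x ≠ 0 := ae_all_iff.2 fun i => by
    filter_upwards [hσtop i] with x hx hx0
    simp only [σ, hx0, ENNReal.coe_zero] at hx
    exact hx (ENNReal.zero_rpow_of_neg (neg_lt_zero.2 (hp1 i)))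
  have hu0 : ∀ᵐ x, u x ≠ 0 := by
    filter_upwards [hv0] with x hx
    rw [Ne, ENNReal.rpow_eq_zero_iff_of_pos hq0]
    exact Finset.prod_ne_zero_iff.2 fun i _ => ENNReal.coe_ne_zero.2 (hx i)
  have h1 : ∀ᵐ x, u x ^ E * ∏ i, σ i x ^ (1 - 1 / ss i) = 1 := by
    filter_upwards [hv0] with x hx
    simp only [u, σ]
    rw [← ENNReal.rpow_mul, ← ENNReal.prod_rpow_of_nonneg (by positivity),
      ← Finset.prod_mul_distrib]
    refine Finset.prod_eq_one fun i _ => ?_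
    rw [← ENNReal.rpow_mul, ← ENNReal.rpow_add _ _ (ENNReal.coe_ne_zero.2 (hx i))
      ENNReal.coe_ne_top, (hrel i).2.2.2.2.2.2, neg_mul, add_neg_cancel, ENNReal.rpow_zero]
  obtain ⟨C, hC, hCf⟩ := MultiFrac.exists_lintegral_iSup_cube_le hu hσ hs0 hs1 h1 hu0
    (fun i => Filter.Eventually.of_forall (hσ0 i)) hσtop hufin hσfin hKfin hK hp0 hβ0.le hβ1
    (fun i => (hrel i).2.2.1) hq'
  have hCq : C ^ (1 / q) ≠ ∞ := ENNReal.rpow_ne_top_of_nonneg (by positivity) hC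
  refine ⟨(C ^ (1 / q)).toNNReal, fun f hf => ?_⟩
  rw [ENNReal.coe_toNNReal hCq]
  have hfm : ∀ i, AEMeasurable (fun x => ‖f i x‖ₑ) volume := fun i => (hf i).enorm
  set F : Fin m → (Fin n → ℝ) → ℝ≥0∞ := fun i => (hfm i).mk _
  have hF : ∀ i, Measurable (F i) := fun i => (hfm i).measurable_mk
  have hFf : ∀ᵐ x, ∀ i, ‖f i x‖ₑ = F i x := ae_all_iff.2 fun i => (hfm i).ae_eq_mk
  have hfrac : ∀ x, MultiFrac.fracMaximal α f x
      = ⨆ (a : Fin n → ℝ) (r : ℝ) (_ : 0 < r) (_ : x ∈ MultiFrac.cube a r),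
        volume (MultiFrac.cube a r) ^ (Fintype.card (Fin m) * β)
          * ∏ i, ⨍⁻ y in MultiFrac.cube a r, F i y ∂volume := by
    intro x
    have hexp : α / n = Fintype.card (Fin m) * β := by
      rw [Fintype.card_fin, hβdef]
      field_simp
    rw [MultiFrac.fracMaximal, hexp]
    have havg : ∀ i (Q : Set (Fin n → ℝ)), ⨍⁻ y in Q, ‖f i y‖ₑ ∂volume = ⨍⁻ y in Q, F i y ∂volume :=
      fun i Q => laverage_congr (ae_restrict_of_ae (hFf.mono fun x hx => hx i))
    simp_rw [havg]
  have hnorm : ∀ i, eLpNorm (fun x => (w i x : ℝ) • f i x) (ENNReal.ofReal (p i)) volume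
      = (∫⁻ x, (F i x / σ i x) ^ p i * σ i x) ^ (1 / p i) := by
    intro i
    rw [eLpNorm_eq_lintegral_rpow_enorm_toReal (by simpa using hp0 i) ENNReal.ofReal_ne_top,
      ENNReal.toReal_ofReal (hp0 i).le]
    congr 1
    refine lintegral_congr_ae ?_
    filter_upwards [hwv, hv0, hFf] with x hx hx0 hFx
    simp only [σ]
    rw [MultiFrac.div_rpow_neg_rpow_mul _ (hx0 i) (hp i).1, enorm_smul, hFx i, hx i]
    congr 2
    exact NNReal.enorm_eq _
  calc eLpNorm (fun x => MultiFrac.fracMaximal α f x * ∏ i, (w i x : ℝ≥0∞))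
          (ENNReal.ofReal q) volume
      = (∫⁻ x, MultiFrac.fracMaximal α f x ^ q * u x) ^ (1 / q) := by
        rw [eLpNorm_eq_lintegral_rpow_enorm_toReal (by simpa using hq0) ENNReal.ofReal_ne_top,
          ENNReal.toReal_ofReal hq0.le]
        congr 1
        refine lintegral_congr_ae ?_
        filter_upwards [hwv] with x hx
        rw [enorm_eq_self, ENNReal.mul_rpow_of_nonneg _ _ hq0.le]
        simp only [u, hx]
    _ ≤ (C * ∏ i, (∫⁻ x, (F i x / σ i x) ^ p i * σ i x) ^ (q / p i)) ^ (1 / q) := by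
        gcongr
        simp_rw [hfrac]
        exact hCf F hF
    _ = _ := by
        rw [ENNReal.mul_rpow_of_nonneg _ _ (by positivity),
          ← ENNReal.prod_rpow_of_nonneg (by positivity)]
        congr 1
        refine Finset.prod_congr rfl fun i _ => ?_
        rw [hnorm i, ← ENNReal.rpow_mul]
        congr 1
        field_simp
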